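/- Let $\mathbb P,\mathbb Q$ be probability measures on a measurable space $\mathcal X$ with measurable densities $p_0,q_0\ge 0$ with respect to a common measure, put $g_0=p_0/q_0$, and let $D_K(\mathbb P,\mathbb Q)$ be the Kullback–Leibler divergence ($D_K=\infty$ if $\mathbb P\not\ll\mathbb Q$). Let $X_1,X_2,\dots$ be i.i.d. from $\mathbb P$ and $Y_1,Y_2,\dots$ i.i.d. from $\mathbb Q$, all defined on one probability space, with empirical distributions $\mathbb P_n=\frac1n\sum_{i\le n}\delta_{X_i}$ and $\mathbb Q_n=\frac1n\sum_{i\le n}\delta_{Y_i}$. Let $\mathcal G$ be a class of measurable functions $g:\mathcal X\to[0,\infty)$. Almost surely, for every $n\ge1$, let $\hat g_n\in\mathcal G$ maximize $\int\log g\,d\mathbb P_n-\int g\,d\mathbb Q_n$ over $g\in\mathcal G$ (with $\log 0=-\infty$), and set $\hat D_K=\int\log\hat g_n\,d\mathbb P_n-\int\hat g_n\,d\mathbb Q_n+1$. Write $h_{\mathbb Q}^2(g_0,g)=\frac12\int(\sqrt{g_0}-\sqrt g)^2\,d\mathbb Q$. For a class $\mathcal F$ of functions, let $H_\delta(\mathcal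 F,L_1(\mathbb P_n))=\log N_\delta(\mathcal F,L_1(\mathbb P_n))$, where $N_\delta$ is the smallest number of $L_1(\mathbb P_n)$-balls of radius $\delta$, with arbitrary real functions as centres, that cover $\mathcal F$ ($N_\delta=\infty$ if there is no finite cover); likewise for $\mathbb Q_n$. Let $G_0(x)=\sup_{g\in\mathcal G}|g(x)|$ and $G_1(x)=\sup_{g\in\mathcal G}\left|\log\frac{g(x)}{g_0(x)}\right|$. As usual in empirical process theory, each class $\mathcal F$ whose entropy is restricted below is assumed to be measurable in the following sense: for every $n$ and all real $e_1,\dots,e_n$, the map $(x_1,\dots,x_n)\mapsto\sup_{f\in\mathcal F}\left|\sum_{i}e_if(x_i)\right|$ is measurable for the completion of the corresponding product measure ($\mathbb P^n$ for entropies in $L_1(\mathbb P_n)$, $\mathbb Q^n$ for entropies in $L_1(\mathbb Q_n)$). Convergence in probability of entropies is understood in outer probability. Assume $D_K(\mathbb P,\mathbb Q)<\infty$ and that some $g\in\mathcal G$ equals $g_0$ $\mathbb Q$-almost everywhere. (a) Suppose that $\int G_0\,d\mathbb Q<\infty$ and $\int G_1\,d\mathbb P<\infty$, and that for every $\delta>0$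 $$\tfrac1n H_\delta(\mathcal G-g_0,L_1(\mathbb Q_n))\to0\quad\text{and}\quad\tfrac1n H_\delta\left(\log(\mathcal G/g_0),L_1(\mathbb P_n)\right)\to0$$ in probability. Then $|\hat D_K-D_K(\mathbb P,\mathbb Q)|\to0$ almost surely and $h_{\mathbb Q}(g_0,\hat g_n)\to0$ almost surely. (b) Suppose only that $\int G_0\,d\mathbb Q<\infty$ and that for every $\delta>0$ $$\tfrac1n H_\delta(\mathcal G-g_0,L_1(\mathbb Q_n))\to0\quad\text{and}\quad\tfrac1n H_\delta\left(\log\tfrac{\mathcal G+g_0}{2g_0},L_1(\mathbb P_n)\right)\to0$$ in probability. Then $h_{\mathbb Q}(g_0,\hat g_n)\to0$ almost surely. -/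

import Mathlib

open MeasureTheory ProbabilityTheory Filter Topology
open scoped ENNReal NNReal

noncomputable section

namespace KLEstimation

variable {𝒳 : Type*}

/-- The logarithm of a nonnegative real number, with `log 0 = -∞`. -/
def elog (t : ℝ) : EReal := ENNReal.log (ENNReal.ofReal t)

/-- The empirical mean `(1/n) ∑ f(x_i)`, i.e. the integral of `f` against the empirical
distribution of the points `x_1, …, x_n` (used for `n ≥ 1`). -/
def empMean {n : ℕ} (x : Fin n → 𝒳) (f : 𝒳 → EReal) : EReal :=
  (∑ i, f (x i)) / (n : EReal)

/-- The empirical criterion `∫ log g dP_n - ∫ g dQ_n`, where `x` is the sample from `P` and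
`y` the sample from `Q`. Its value is `-∞` exactly when `g` vanishes at some `x_i`. -/
def criterion {n : ℕ} (x y : Fin n → 𝒳) (g : 𝒳 → ℝ) : EReal :=
  empMean x (fun t => elog (g t)) - empMean y (fun t => (g t : EReal))

/-- `ghat` maximizes the empirical criterion over the class `G`. -/
def IsE1Estimate (G : Set (𝒳 → ℝ)) {n : ℕ} (x y : Fin n → 𝒳) (ghat : 𝒳 → ℝ) : Prop :=
  ghat ∈ G ∧ ∀ g ∈ G, criterion x y g ≤ criterion x y ghat

/-- The plug-in estimate `∫ log ghat dP_n - ∫ ghat dQ_n + 1` of the KL divergence. -/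
def klEstimate {n : ℕ} (x y : Fin n → 𝒳) (ghat : 𝒳 → ℝ) : EReal :=
  criterion x y ghat + 1

/-- The (generalized) Hellinger distance `(½ ∫ (√g₀ - √g)² dQ)^{1/2}`. -/
def hellinger [MeasurableSpace 𝒳] (Q : Measure 𝒳) (g₀ g : 𝒳 → ℝ) : ℝ≥0∞ :=
  ((∫⁻ x, ENNReal.ofReal ((√(g₀ x) - √(g x)) ^ 2) ∂Q) / 2) ^ (1 / 2 : ℝ)

/-- The envelope `sup_{f ∈ F} |f(x)|` of a class of functions. -/
def envelope (F : Set (𝒳 → EReal)) (x : 𝒳) : ℝ≥0∞ := ⨆ f ∈ F, (f x).abs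

/-- The `L₁` distance `(1/n) ∑ |f(x_i) - c(x_i)|` with respect to the empirical distribution
of `x_1, …, x_n`. It is `∞` if `f` is infinite at some `x_i`. -/
def empDist {n : ℕ} (x : Fin n → 𝒳) (f : 𝒳 → EReal) (c : 𝒳 → ℝ) : ℝ≥0∞ :=
  (∑ i, (f (x i) - (c (x i) : EReal)).abs) / (n : ℝ≥0∞)

/-- The covering number `N_δ(F, L₁(P_n))`: the least number of balls of radius `δ`, centred at
arbitrary functions, that cover `F`; it is `∞` if no finite cover exists. -/
def coveringNumber (δ : ℝ≥0) (F : Set (𝒳 → EReal)) {n : ℕ} (x : Fin n → 𝒳) : ℕ∞ :=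
  ⨅ (C : Finset (𝒳 → ℝ)) (_ : ∀ f ∈ F, ∃ c ∈ C, empDist x f c ≤ (δ : ℝ≥0∞)), (C.card : ℕ∞)

/-- The metric entropy `H_δ(F, L₁(P_n)) = log N_δ(F, L₁(P_n))` (with `log ∞ = ∞`; the covering
number of a nonempty class is at least `1`, so no truncation takes place). -/
def metricEntropy (δ : ℝ≥0) (F : Set (𝒳 → EReal)) {n : ℕ} (x : Fin n → 𝒳) : ℝ≥0∞ :=
  (ENNReal.log ((coveringNumber δ F x : ℕ∞) : ℝ≥0∞)).toENNReal

/-- The usual measurability requirement of empirical process theory on a class `F`: for every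
`n` and all real weights `e_1, …, e_n`, the supremum `sup_{f ∈ F} |∑ e_i f(x_i)|` is a
measurable function of `(x_1, …, x_n)` for the completion of the `n`-fold product of `μ`. -/
def SupMeasurable [MeasurableSpace 𝒳] (μ : Measure 𝒳) (F : Set (𝒳 → EReal)) : Prop :=
  ∀ (n : ℕ) (e : Fin n → ℝ),
    AEMeasurable (fun x : Fin n → 𝒳 => ⨆ f ∈ F, (∑ i, (e i : EReal) * f (x i)).abs)
      (Measure.pi fun _ : Fin n => μ)

/-- The class `G`, with its elements regarded as extended-real-valued functions. -/
def classG (G : Set (𝒳 → ℝ)) : Set (𝒳 → EReal) :=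
  (fun g x => ((g x : ℝ) : EReal)) '' G

/-- The class `G - g₀`. -/
def classSub (G : Set (𝒳 → ℝ)) (g₀ : 𝒳 → ℝ) : Set (𝒳 → EReal) :=
  (fun g x => ((g x - g₀ x : ℝ) : EReal)) '' G

/-- The class `log (G / g₀)`. -/
def classLog (G : Set (𝒳 → ℝ)) (g₀ : 𝒳 → ℝ) : Set (𝒳 → EReal) :=
  (fun g x => elog (g x / g₀ x)) '' G

/-- The class `log ((G + g₀) / (2 g₀))`. -/
def classLogMid (G : Set (𝒳 → ℝ)) (g₀ : 𝒳 → ℝ) : Set (𝒳 → EReal) :=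
  (fun g x => elog ((g x + g₀ x) / (2 * g₀ x))) '' G

/-- For every `δ > 0`, `(1/n) H_δ(F, L₁(P_n)) → 0` in probability, where `P_n` is the empirical
distribution of the first `n` terms of the random sequence `Z`. -/
def EntropyCondition {Ω : Type*} [MeasurableSpace Ω] (Pr : Measure Ω) (Z : ℕ → Ω → 𝒳)
    (F : Set (𝒳 → EReal)) : Prop :=
  ∀ δ : ℝ≥0, 0 < δ → ∀ ε : ℝ≥0∞, 0 < ε →
    Tendsto (fun n : ℕ =>
      Pr {ω | ε ≤ metricEntropy δ F (fun i : Fin n => Z i ω) / (n : ℝ≥0∞)}) atTop (𝓝 0)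

/-- `Z_0, Z_1, …` are independent with common law `μ`. -/
structure IsIIDSample {Ω : Type*} [MeasurableSpace Ω] [MeasurableSpace 𝒳] (Pr : Measure Ω)
    (μ : Measure 𝒳) (Z : ℕ → Ω → 𝒳) : Prop where
  measurable : ∀ i, Measurable (Z i)
  map_eq : ∀ i, Pr.map (Z i) = μ
  indep : iIndepFun Z Pr

end KLEstimation

end

/-! Since some member of `G` agrees with `g₀` at all sample points almost surely, maximality gives
the basic inequality `∑ log (ĝ/g₀)(X_i) - ∑ (ĝ - g₀)(Y_i) ≥ 0`. If empirical means are uniformly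
close to expectations over both classes, the same combination of expectations is at least `-ε`. But
`log t ≤ 2(√t - 1)`, integrated against `P = g₀ Q`, bounds `∫ log (g/g₀) dP - ∫ (g - g₀) dQ` above
by `-∫ (√g₀ - √g)² dQ`; no normalization of `g` is needed. The Hellinger distance is therefore
squeezed to zero (`hellinger_sq_le`). The empirical combination, divided by `n`, is squeezed to zero
as well, and the estimate differs from it by ordinary averages of `log g₀` and `g₀`, handled by the
strong law. For (b), concavity of the logarithm replaces `g` by the midpoint `(g + g₀)/2`. Its
log-ratio has an envelope controlled by that of `G` itself, and its Hellinger distance to `g₀` is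
comparable to that of `g` (`sq_sqrt_sub_sqrt_le_midpoint`).

The analytic core is the uniform strong law `ae_eventually_uniform_sum_le`. Covers of subexponential
size and the Rademacher maximal inequality, with truncation at a level of the envelope, show that
the symmetrized supremum over `k` pairs has mean at most `kε` for large `k`. Almost sure convergence
then needs only one such `k`. Integrating out the ghost half of the sample leaves a single function
`u` of a block of `k` points which dominates every centred block sum and has mean at most `kε`. The
ordinary strong law for `u` over disjoint blocks bounds the averages of all members of the class at
once. -/

noncomputable section

/-! ### Rademacher sums over a finitely covered class. -/

namespace KLEstimation

variable {𝒳 : Type*}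

/-- The supremum of `|∑ e_i f(x_i)|` over the class `F`. -/
def weightedSup (F : Set (𝒳 → EReal)) {n : ℕ} (e : Fin n → ℝ) (x : Fin n → 𝒳) : ℝ≥0∞ :=
  ⨆ f ∈ F, (∑ i, (e i : EReal) * f (x i)).abs

/-- The sign `±1` encoded by a Boolean. -/
def boolSign (b : Bool) : ℝ := if b then 1 else -1

lemma abs_boolSign (b : Bool) : |boolSign b| = 1 := by cases b <;> simp [boolSign]

lemma ereal_abs_add_le (a b : EReal) : (a + b).abs ≤ a.abs + b.abs := by
  induction a using EReal.rec <;> induction b using EReal.rec <;> simp [← EReal.coe_add]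
  rename_i a b
  rw [EReal.abs_def, EReal.abs_def, EReal.abs_def, ← ENNReal.ofReal_add (abs_nonneg _) (abs_nonneg _)]
  exact ENNReal.ofReal_le_ofReal (abs_add_le a b)

lemma ereal_abs_sum_le {ι : Type*} (s : Finset ι) (a : ι → EReal) :
    (∑ i ∈ s, a i).abs ≤ ∑ i ∈ s, (a i).abs := by
  classical
  induction s using Finset.induction_on with
  | empty => simp
  | insert i s hi ih =>
    rw [Finset.sum_insert hi, Finset.sum_insert hi]
    exact (ereal_abs_add_le _ _).trans (by gcongr)

lemma ereal_coe_sum {ι : Type*} (s : Finset ι) (a : ι → ℝ) :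
    ((∑ i ∈ s, a i : ℝ) : EReal) = ∑ i ∈ s, (a i : EReal) :=
  map_sum (⟨⟨Real.toEReal, EReal.coe_zero⟩, EReal.coe_add⟩ : ℝ →+ EReal) a s

lemma ofReal_abs_toReal_le (a : EReal) : ENNReal.ofReal |a.toReal| ≤ a.abs := by
  induction a using EReal.rec with
  | bot => simp
  | top => simp
  | coe a => rw [EReal.toReal_coe, EReal.abs_def]

lemma abs_boolSign_mul (b : Bool) (a : EReal) : ((boolSign b : EReal) * a).abs = a.abs := by
  rw [EReal.abs_mul, EReal.abs_def, abs_boolSign]; simp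

lemma abs_le_envelope {F : Set (𝒳 → EReal)} {f : 𝒳 → EReal} (hf : f ∈ F) (x : 𝒳) :
    (f x).abs ≤ envelope F x := le_iSup₂_of_le f hf le_rfl

lemma weightedSup_boolSign_le (F : Set (𝒳 → EReal)) {n : ℕ} (b : Fin n → Bool) (x : Fin n → 𝒳) :
    weightedSup F (fun i => boolSign (b i)) x ≤ ∑ i, envelope F (x i) := by
  refine iSup₂_le fun f hf => (ereal_abs_sum_le _ _).trans ?_
  gcongr with i
  rw [abs_boolSign_mul]
  exact abs_le_envelope hf _

lemma sum_exp_boolSign {n : ℕ} (a : Fin n → ℝ) :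
    ∑ b : Fin n → Bool, Real.exp (∑ i, boolSign (b i) * a i) = ∏ i, (2 * Real.cosh (a i)) := by
  have h : ∀ i, 2 * Real.cosh (a i) = ∑ b : Bool, Real.exp (boolSign b * a i) := by
    intro i; simp [boolSign, Real.cosh_eq]; ring
  simp_rw [h, Real.exp_sum]
  rw [Finset.prod_univ_sum, Fintype.piFinset_univ]

/-- Hoeffding's bound from `cosh x ≤ exp (x²/2)`. Expectations over random signs appear throughout
as sums over all `2 ^ n` sign vectors. -/
lemma sum_exp_boolSign_le {n : ℕ} (a : Fin n → ℝ) {M : ℝ} (ha : ∀ i, |a i| ≤ M) :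
    ∑ b : Fin n → Bool, Real.exp (∑ i, boolSign (b i) * a i)
      ≤ 2 ^ n * Real.exp (n * (M ^ 2 / 2)) := by
  rw [sum_exp_boolSign]
  calc ∏ i, (2 * Real.cosh (a i)) ≤ ∏ _i : Fin n, (2 * Real.exp (M ^ 2 / 2)) := by
        refine Finset.prod_le_prod (fun i _ => by positivity) fun i _ => ?_
        have h1 := Real.cosh_le_exp_half_sq (a i)
        have h2 : a i ^ 2 ≤ M ^ 2 := by
          rw [← sq_abs]; exact pow_le_pow_left₀ (abs_nonneg _) (ha i) 2
        have h3 : Real.exp (a i ^ 2 / 2) ≤ Real.exp (M ^ 2 / 2) := Real.exp_le_exp.2 (by linarith)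
        linarith
    _ = _ := by
        rw [Finset.prod_const, Finset.card_univ, Fintype.card_fin, mul_pow, ← Real.exp_nat_mul]

/-- A maximal inequality for Rademacher sums. -/
lemma sum_rademacher_max_le {κ : Type*} {n : ℕ} (C : Finset κ) (v : κ → Fin n → ℝ) {M K t : ℝ}
    (hv : ∀ c i, |v c i| ≤ M) (hK : 0 < K) (hCK : (C.card : ℝ) ≤ K) (ht : 0 < t)
    (m : (Fin n → Bool) → ℝ) (hm : ∀ b, ∃ c ∈ C, m b = |∑ i, boolSign (b i) * v c i|) :
    ∑ b, m b ≤ 2 ^ n * (Real.log (2 * K) / t + n * (t * M ^ 2 / 2)) := by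
  set A : ℝ := Real.exp (n * ((t * M) ^ 2 / 2)) with hA
  have hApos : 0 < A := Real.exp_pos _
  -- The tangent line of the logarithm at `2 * K * A` takes the place of Jensen's inequality: the
  -- last term averages to at most `1` over `b`, which cancels the `-1`.
  have key : ∀ b, t * m b ≤ Real.log (2 * K * A) - 1 + Real.exp (t * m b) / (2 * K * A) := by
    intro b
    have h := Real.log_le_sub_one_of_pos
      (show 0 < Real.exp (t * m b) / (2 * K * A) by positivity)
    rw [Real.log_div (by positivity) (by positivity), Real.log_exp] at h
    linarith
  have hexp : ∀ b, Real.exp (t * m b) ≤ ∑ c ∈ C, (Real.exp (∑ i, boolSign (b i) * (t * v c i))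
      + Real.exp (∑ i, boolSign (b i) * (-t * v c i))) := by
    intro b
    obtain ⟨c, hc, hmc⟩ := hm b
    refine le_trans ?_ (Finset.single_le_sum
      (f := fun c => Real.exp (∑ i, boolSign (b i) * (t * v c i))
        + Real.exp (∑ i, boolSign (b i) * (-t * v c i))) (fun _ _ => by positivity) hc)
    have e1 : ∑ i, boolSign (b i) * (t * v c i) = t * ∑ i, boolSign (b i) * v c i := by
      rw [Finset.mul_sum]; exact Finset.sum_congr rfl fun i _ => by ring
    have e2 : ∑ i, boolSign (b i) * (-t * v c i) = t * -∑ i, boolSign (b i) * v c i := by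
      rw [mul_neg, Finset.mul_sum, ← Finset.sum_neg_distrib]
      exact Finset.sum_congr rfl fun i _ => by ring
    rw [e1, e2, hmc]
    rcases abs_choice (∑ i, boolSign (b i) * v c i) with h | h <;> rw [h]
    · linarith [Real.exp_pos (t * -∑ i, boolSign (b i) * v c i)]
    · linarith [Real.exp_pos (t * ∑ i, boolSign (b i) * v c i)]
  have hsum : ∑ b, Real.exp (t * m b) ≤ 2 ^ n * (2 * K * A) := by
    calc ∑ b, Real.exp (t * m b) ≤ ∑ b : Fin n → Bool, ∑ c ∈ C,
          (Real.exp (∑ i, boolSign (b i) * (t * v c i))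
            + Real.exp (∑ i, boolSign (b i) * (-t * v c i))) := Finset.sum_le_sum fun b _ => hexp b
      _ = ∑ c ∈ C, ((∑ b : Fin n → Bool, Real.exp (∑ i, boolSign (b i) * (t * v c i)))
            + ∑ b : Fin n → Bool, Real.exp (∑ i, boolSign (b i) * (-t * v c i))) := by
          rw [Finset.sum_comm]; simp_rw [Finset.sum_add_distrib]
      _ ≤ ∑ _c ∈ C, (2 ^ n * A + 2 ^ n * A) := by
          refine Finset.sum_le_sum fun c _ => add_le_add (sum_exp_boolSign_le _ fun i => ?_)
            (sum_exp_boolSign_le _ fun i => ?_)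
          · rw [abs_mul, abs_of_pos ht]; exact mul_le_mul_of_nonneg_left (hv c i) ht.le
          · rw [abs_mul, abs_neg, abs_of_pos ht]; exact mul_le_mul_of_nonneg_left (hv c i) ht.le
      _ = C.card * (2 ^ n * (2 * A)) := by rw [Finset.sum_const, nsmul_eq_mul]; ring
      _ ≤ K * (2 ^ n * (2 * A)) := by gcongr
      _ = _ := by ring
  have htot : t * ∑ b, m b ≤ 2 ^ n * Real.log (2 * K * A) := by
    calc t * ∑ b, m b = ∑ b, t * m b := Finset.mul_sum _ _ _
      _ ≤ ∑ b, (Real.log (2 * K * A) - 1 + Real.exp (t * m b) / (2 * K * A)) :=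
          Finset.sum_le_sum fun b _ => key b
      _ = 2 ^ n * (Real.log (2 * K * A) - 1) + (∑ b, Real.exp (t * m b)) / (2 * K * A) := by
          rw [Finset.sum_add_distrib, Finset.sum_div]; simp; ring
      _ ≤ 2 ^ n * (Real.log (2 * K * A) - 1) + 2 ^ n * (2 * K * A) / (2 * K * A) := by gcongr
      _ = _ := by rw [mul_div_assoc, div_self (by positivity)]; ring
  have hlog : Real.log (2 * K * A) = Real.log (2 * K) + n * ((t * M) ^ 2 / 2) := by
    rw [Real.log_mul (by positivity) hApos.ne', hA, Real.log_exp]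
  rw [hlog] at htot
  have : ∑ b, m b ≤ (2 ^ n * (Real.log (2 * K) + n * ((t * M) ^ 2 / 2))) / t := by
    rw [le_div_iff₀ ht]; linarith
  refine this.trans (le_of_eq ?_)
  field_simp

/-- The part of the envelope of `F` that exceeds the level `M`. -/
def envelopeTail (F : Set (𝒳 → EReal)) (M : ℝ≥0) (x : 𝒳) : ℝ≥0∞ :=
  if envelope F x ≤ M then 0 else envelope F x

lemma envelope_le_add_tail (F : Set (𝒳 → EReal)) (M : ℝ≥0) (x : 𝒳) :
    envelope F x ≤ M + envelopeTail F M x := by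
  unfold envelopeTail
  split_ifs with h
  · simpa using h
  · exact le_add_self

/-- The values of a centre, truncated to `[-M, M]` and set to `0` where the envelope
exceeds `M`. -/
def truncCentre (F : Set (𝒳 → EReal)) (M : ℝ≥0) (c : 𝒳 → ℝ) (x : 𝒳) : ℝ :=
  if envelope F x ≤ M then max (-M) (min M (c x)) else 0

lemma abs_truncCentre_le (F : Set (𝒳 → EReal)) (M : ℝ≥0) (c : 𝒳 → ℝ) (x : 𝒳) :
    |truncCentre F M c x| ≤ M := by
  have hM := M.coe_nonneg
  unfold truncCentre
  split_ifs
  · rw [abs_le]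
    exact ⟨le_max_left _ _, max_le (by linarith) (min_le_left _ _)⟩
  · simp

lemma abs_sub_clip_le {a c M : ℝ} (ha : |a| ≤ M) : |a - max (-M) (min M c)| ≤ |a - c| := by
  rw [abs_le] at ha
  rcases le_total M c with h | h
  · rw [min_eq_left h, max_eq_right (by linarith), abs_of_nonpos (by linarith),
      abs_of_nonpos (by linarith)]; linarith
  · rw [min_eq_right h]
    rcases le_total (-M) c with h' | h'
    · rw [max_eq_right h']
    · rw [max_eq_left h', abs_of_nonneg (by linarith), abs_of_nonneg (by linarith)]; linarith

/-- Centres of a cover are arbitrary, so they must be made bounded before the maximal inequality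
applies. Where the envelope is at most `M`, clipping the centre to `[-M, M]` only brings it closer
to `f`; elsewhere the centre is `0` and the error is charged to the tail. -/
lemma abs_sum_boolSign_le_centre {F : Set (𝒳 → EReal)} {f : 𝒳 → EReal} (hf : f ∈ F) {n : ℕ}
    (hn : n ≠ 0) (x : Fin n → 𝒳) (b : Fin n → Bool) (M δ : ℝ≥0) (c : 𝒳 → ℝ)
    (hc : empDist x f c ≤ δ) :
    (∑ i, (boolSign (b i) : EReal) * f (x i)).abs ≤
      ENNReal.ofReal |∑ i, boolSign (b i) * truncCentre F M c (x i)| + (n * δ : ℝ≥0)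
        + ∑ i, envelopeTail F M (x i) := by
  have hdist : ∑ i, (f (x i) - (c (x i) : EReal)).abs ≤ (n * δ : ℝ≥0) := by
    unfold empDist at hc
    rw [ENNReal.div_le_iff (by simpa using hn) (by simp)] at hc
    refine hc.trans (le_of_eq ?_)
    push_cast; ring
  have hterm : ∀ i, (f (x i) - (truncCentre F M c (x i) : EReal)).abs ≤
      (f (x i) - (c (x i) : EReal)).abs + envelopeTail F M (x i) := by
    intro i
    have hfe := abs_le_envelope hf (x i)
    unfold truncCentre envelopeTail
    split_ifs with h
    · rw [add_zero]
      have hfin := hfe.trans h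
      induction hfx : f (x i) using EReal.rec with
      | bot => simp [hfx] at hfin
      | top => simp [hfx] at hfin
      | coe a =>
        rw [hfx, EReal.abs_def] at hfin
        have ha : |a| ≤ M := by
          rw [← ENNReal.ofReal_coe_nnreal] at hfin
          exact (ENNReal.ofReal_le_ofReal_iff M.coe_nonneg).1 hfin
        rw [← EReal.coe_sub, ← EReal.coe_sub, EReal.abs_def, EReal.abs_def]
        exact ENNReal.ofReal_le_ofReal (abs_sub_clip_le ha)
    · simp only [EReal.coe_zero, sub_zero]
      exact hfe.trans le_add_self
  have hsplit : (∑ i, (boolSign (b i) : EReal) * f (x i)).abs ≤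
      ENNReal.ofReal |∑ i, boolSign (b i) * truncCentre F M c (x i)|
        + ∑ i, (f (x i) - (truncCentre F M c (x i) : EReal)).abs := by
    -- Additive splitting is valid for real values only; if `f` is infinite at a sample point, the
    -- distance on the right is `⊤`.
    by_cases hfin : ∀ i, ∃ a : ℝ, f (x i) = a
    · choose a ha using hfin
      simp only [ha]
      have e : ∑ i, (boolSign (b i) : EReal) * (a i : EReal)
          = ((∑ i, boolSign (b i) * truncCentre F M c (x i) : ℝ) : EReal)
            + ∑ i, (boolSign (b i) : EReal) * ((a i : EReal) - (truncCentre F M c (x i) : EReal)) := by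
        simp only [← EReal.coe_mul, ← EReal.coe_sub, ← ereal_coe_sum, ← EReal.coe_add]
        rw [← Finset.sum_add_distrib]
        congr 1
        exact Finset.sum_congr rfl fun i _ => by ring
      rw [e]
      refine (ereal_abs_add_le _ _).trans ?_
      rw [EReal.abs_def]
      gcongr
      refine (ereal_abs_sum_le _ _).trans (le_of_eq ?_)
      exact Finset.sum_congr rfl fun i _ => abs_boolSign_mul _ _
    · push Not at hfin
      obtain ⟨i, hi⟩ := hfin
      have : ∑ i, (f (x i) - (truncCentre F M c (x i) : EReal)).abs = ⊤ := by
        rw [ENNReal.sum_eq_top]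
        refine ⟨i, Finset.mem_univ _, ?_⟩
        induction hfx : f (x i) using EReal.rec with
        | bot => simp
        | top => simp
        | coe a => exact absurd hfx (hi a)
      rw [this]; simp
  refine hsplit.trans ?_
  rw [add_assoc]
  gcongr
  calc _ ≤ ∑ i, ((f (x i) - (c (x i) : EReal)).abs + envelopeTail F M (x i)) :=
        Finset.sum_le_sum fun i _ => hterm i
    _ ≤ _ := by rw [Finset.sum_add_distrib]; gcongr

lemma sum_weightedSup_le_of_cover {F : Set (𝒳 → EReal)} (hF : F.Nonempty) {n : ℕ} (hn : n ≠ 0)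
    (x : Fin n → 𝒳) (M δ : ℝ≥0) {K t : ℝ} (hK : 0 < K) (ht : 0 < t) (C : Finset (𝒳 → ℝ))
    (hCK : (C.card : ℝ) ≤ K) (hC : ∀ f ∈ F, ∃ c ∈ C, empDist x f c ≤ (δ : ℝ≥0∞)) :
    ∑ b : Fin n → Bool, weightedSup F (fun i => boolSign (b i)) x ≤
      2 ^ n * (ENNReal.ofReal (Real.log (2 * K) / t + n * (t * M ^ 2 / 2) + n * δ)
        + ∑ i, envelopeTail F M (x i)) := by
  obtain ⟨f₀, hf₀⟩ := hF
  have hCne : C.Nonempty := by obtain ⟨c, hc, -⟩ := hC f₀ hf₀; exact ⟨c, hc⟩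
  have hmax : ∀ b : Fin n → Bool, ∃ c ∈ C, ∀ c' ∈ C,
      |∑ i, boolSign (b i) * truncCentre F M c' (x i)|
        ≤ |∑ i, boolSign (b i) * truncCentre F M c (x i)| := fun b =>
    Finset.exists_max_image C _ hCne
  choose cb hcb hcbmax using hmax
  set m : (Fin n → Bool) → ℝ := fun b => |∑ i, boolSign (b i) * truncCentre F M (cb b) (x i)|
  have hm := sum_rademacher_max_le C (fun c i => truncCentre F M c (x i))
    (fun c i => abs_truncCentre_le F M c (x i)) hK hCK ht m (fun b => ⟨cb b, hcb b, rfl⟩)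
  calc ∑ b : Fin n → Bool, weightedSup F (fun i => boolSign (b i)) x
      ≤ ∑ b : Fin n → Bool, (ENNReal.ofReal (m b) + ((n * δ : ℝ≥0) : ℝ≥0∞)
          + ∑ i, envelopeTail F M (x i)) := by
        refine Finset.sum_le_sum fun b _ => iSup₂_le fun f hf => ?_
        obtain ⟨c, hc, hd⟩ := hC f hf
        refine (abs_sum_boolSign_le_centre hf hn x b M δ c hd).trans ?_
        gcongr
        exact hcbmax b c hc
    _ = ENNReal.ofReal (∑ b, m b) + 2 ^ n * (((n * δ : ℝ≥0) : ℝ≥0∞)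
          + ∑ i, envelopeTail F M (x i)) := by
        simp_rw [add_assoc]
        rw [Finset.sum_add_distrib, ENNReal.ofReal_sum_of_nonneg fun b _ => abs_nonneg _]
        simp [m, mul_add]
    _ ≤ ENNReal.ofReal (2 ^ n * (Real.log (2 * K) / t + n * (t * M ^ 2 / 2)))
          + 2 ^ n * (((n * δ : ℝ≥0) : ℝ≥0∞) + ∑ i, envelopeTail F M (x i)) := by
        gcongr
    _ = _ := by
        -- `ENNReal.ofReal` is additive on nonnegative terms only; the sign is inherited from the
        -- nonnegative sum that this quantity bounds.
        have hnn : 0 ≤ Real.log (2 * K) / t + n * (t * M ^ 2 / 2) := by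
          by_contra! h
          have : ∑ b, m b < 0 := hm.trans_lt (by
            have : (0:ℝ) < 2 ^ n := by positivity
            nlinarith)
          exact absurd this (not_lt.2 (Finset.sum_nonneg fun b _ => abs_nonneg _))
        rw [ENNReal.ofReal_mul (by positivity), ENNReal.ofReal_pow (by norm_num),
          ENNReal.ofReal_add hnn (by positivity), ENNReal.coe_nnreal_eq (_ * _)]
        push_cast
        simp only [ENNReal.ofReal_ofNat]
        ring

/-- Finite entropy excludes covering number `∞`, and an infimum in `ℕ∞` is attained. A cover of a
nonempty class has at least one centre, so the logarithm is nonnegative and `toENNReal` loses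
nothing. -/
lemma exists_cover_of_metricEntropy_lt {F : Set (𝒳 → EReal)} (hF : F.Nonempty) {n : ℕ}
    (hn : n ≠ 0) (x : Fin n → 𝒳) (δ η : ℝ≥0)
    (h : metricEntropy δ F x / (n : ℝ≥0∞) < η) :
    ∃ C : Finset (𝒳 → ℝ), (C.card : ℝ) ≤ Real.exp (n * η) ∧
      ∀ f ∈ F, ∃ c ∈ C, empDist x f c ≤ (δ : ℝ≥0∞) := by
  have hlt : metricEntropy δ F x < η * n := by
    rwa [ENNReal.div_lt_iff (by simp [hn]) (by simp)] at h
  have hfin : coveringNumber δ F x ≠ ⊤ := by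
    intro htop
    rw [metricEntropy, htop] at hlt
    simp at hlt
  have : ∃ C : Finset (𝒳 → ℝ), (∀ f ∈ F, ∃ c ∈ C, empDist x f c ≤ (δ : ℝ≥0∞)) ∧
      coveringNumber δ F x = C.card := by
    unfold coveringNumber at hfin ⊢
    rw [iInf_subtype'] at hfin ⊢
    have hne : Nonempty {C : Finset (𝒳 → ℝ) //
        ∀ f ∈ F, ∃ c ∈ C, empDist x f c ≤ (δ : ℝ≥0∞)} := by
      by_contra hemp
      rw [not_nonempty_iff] at hemp
      exact hfin (by simp)
    obtain ⟨C, hC⟩ := ENat.exists_eq_iInf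
      (fun C : {C : Finset (𝒳 → ℝ) // ∀ f ∈ F, ∃ c ∈ C, empDist x f c ≤ (δ : ℝ≥0∞)} =>
        ((C : Finset (𝒳 → ℝ)).card : ℕ∞))
    exact ⟨C, C.2, hC.symm⟩
  obtain ⟨C, hC, hcard⟩ := this
  refine ⟨C, ?_, hC⟩
  obtain ⟨f₀, hf₀⟩ := hF
  obtain ⟨c, hc, -⟩ := hC f₀ hf₀
  have hpos : 0 < (C.card : ℝ) := by exact_mod_cast Finset.card_pos.2 ⟨c, hc⟩
  rw [metricEntropy, hcard] at hlt
  have e : ENNReal.log (((C.card : ℕ∞) : ℝ≥0∞)) = ((Real.log C.card : ℝ) : EReal) := by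
    have : (((C.card : ℕ∞) : ℝ≥0∞)) = ENNReal.ofReal C.card := by simp
    rw [this, ENNReal.log_ofReal_of_pos hpos]
  rw [e, EReal.toENNReal_of_ne_top (by simp)] at hlt
  simp only [EReal.toReal_coe] at hlt
  have h2 : (η * n : ℝ≥0∞) = ENNReal.ofReal (n * η) := by
    rw [ENNReal.ofReal_mul (by positivity)]; simp [mul_comm]
  rw [h2] at hlt
  have h3 := (ENNReal.ofReal_lt_ofReal_iff_of_nonneg
    (Real.log_nonneg (by exact_mod_cast Finset.card_pos.2 ⟨c, hc⟩))).1 hlt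
  exact ((Real.log_le_iff_le_exp hpos).1 h3.le)

end KLEstimation

end

/-! ### Symmetrization and the mean of the supremum. -/

noncomputable section

namespace KLEstimation

variable {𝒳 : Type*}

lemma lintegral_comp_of_measurePreserving {α β : Type*} [MeasurableSpace α] [MeasurableSpace β]
    {μ : Measure α} {ν : Measure β} {T : α → β} (hT : MeasurePreserving T μ ν) {g : β → ℝ≥0∞}
    (hg : AEMeasurable g ν) : ∫⁻ a, g (T a) ∂μ = ∫⁻ b, g b ∂ν := by
  have hg' := hg
  rw [← hT.map_eq] at hg' ⊢
  rw [lintegral_map' hg' hT.measurable.aemeasurable]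

/-- Two samples of size `k` joined to one of size `2k`, after exchanging the points whose sign
is `false`. -/
def splice {k : ℕ} (b : Fin k → Bool) (p : (Fin k → 𝒳) × (Fin k → 𝒳)) : Fin (k + k) → 𝒳 :=
  Fin.append (fun i => if b i then p.1 i else p.2 i) (fun i => if b i then p.2 i else p.1 i)

/-- The weights `1, …, 1, -1, …, -1`. -/
def splitSign (k : ℕ) : Fin (k + k) → ℝ := Fin.append (fun _ => 1) (fun _ => -1)

lemma le_weightedSup {F : Set (𝒳 → EReal)} {f : 𝒳 → EReal} (hf : f ∈ F) {n : ℕ} (e : Fin n → ℝ)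
    (x : Fin n → 𝒳) : (∑ i, (e i : EReal) * f (x i)).abs ≤ weightedSup F e x := by
  unfold weightedSup
  exact le_iSup₂_of_le f hf le_rfl

/-- Exchanging the `i`-th pair flips the sign of its contribution `f (p.1 i) - f (p.2 i)`, so the
signs `b` fall on one half and the opposite signs on the other. -/
lemma weightedSup_splice_le (F : Set (𝒳 → EReal)) {k : ℕ} (b : Fin k → Bool)
    (p : (Fin k → 𝒳) × (Fin k → 𝒳)) :
    weightedSup F (splitSign k) (splice b p) ≤
      weightedSup F (fun i => boolSign (b i)) p.1
        + weightedSup F (fun i => boolSign (!b i)) p.2 := by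
  refine iSup₂_le fun f hf => ?_
  have e : ∑ j, (splitSign k j : EReal) * f (splice b p j) =
      (∑ i, (boolSign (b i) : EReal) * f (p.1 i)) + ∑ i, (boolSign (!b i) : EReal) * f (p.2 i) := by
    rw [Fin.sum_univ_add, ← Finset.sum_add_distrib, ← Finset.sum_add_distrib]
    refine Finset.sum_congr rfl fun i _ => ?_
    simp only [splitSign, splice, Fin.append_left, Fin.append_right]
    cases b i <;> simp [boolSign, add_comm]
  rw [e]
  exact (ereal_abs_add_le _ _).trans
    (add_le_add (le_weightedSup hf _ _) (le_weightedSup hf _ _))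

variable [MeasurableSpace 𝒳] {μ : Measure 𝒳}

/-- The preimage of a box is a product of two boxes with some sides exchanged, and its measure is
the same product of factors. -/
lemma measurePreserving_splice [IsProbabilityMeasure μ] {k : ℕ} (b : Fin k → Bool) :
    MeasurePreserving (splice (𝒳 := 𝒳) b)
      ((Measure.pi fun _ : Fin k => μ).prod (Measure.pi fun _ : Fin k => μ))
      (Measure.pi fun _ : Fin (k + k) => μ) := by
  have hmeas : Measurable (splice (𝒳 := 𝒳) b) := by
    refine measurable_pi_lambda _ fun j => ?_
    refine Fin.addCases (fun i => ?_) (fun i => ?_) j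
    · simp only [splice, Fin.append_left]
      split_ifs <;> fun_prop
    · simp only [splice, Fin.append_right]
      split_ifs <;> fun_prop
  refine ⟨hmeas, (Measure.pi_eq fun s hs => ?_).symm⟩
  rw [Measure.map_apply hmeas (MeasurableSet.univ_pi hs)]
  have hpre : splice (𝒳 := 𝒳) b ⁻¹' (Set.univ.pi s) =
      (Set.univ.pi fun i => if b i then s (Fin.castAdd k i) else s (Fin.natAdd k i)) ×ˢ
        (Set.univ.pi fun i => if b i then s (Fin.natAdd k i) else s (Fin.castAdd k i)) := by
    ext p
    simp only [Set.mem_preimage, Set.mem_univ_pi, Set.mem_prod]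
    constructor
    · intro h
      refine ⟨fun i => ?_, fun i => ?_⟩ <;>
      · have h1 := h (Fin.castAdd k i)
        have h2 := h (Fin.natAdd k i)
        simp only [splice, Fin.append_left, Fin.append_right] at h1 h2
        cases hb : b i <;> simp_all
    · rintro ⟨h1, h2⟩ j
      refine Fin.addCases (fun i => ?_) (fun i => ?_) j <;>
      · have h1 := h1 i
        have h2 := h2 i
        simp only [splice, Fin.append_left, Fin.append_right]
        cases hb : b i <;> simp_all
  rw [hpre, Measure.prod_prod, Measure.pi_pi, Measure.pi_pi, Fin.prod_univ_add,
    ← Finset.prod_mul_distrib, ← Finset.prod_mul_distrib]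
  refine Finset.prod_congr rfl fun i _ => ?_
  cases b i <;> simp [mul_comm]

lemma SupMeasurable.aemeasurable {F : Set (𝒳 → EReal)} (h : SupMeasurable μ F) {n : ℕ}
    (e : Fin n → ℝ) : AEMeasurable (weightedSup F e) (Measure.pi fun _ : Fin n => μ) := h n e

lemma SupMeasurable.aemeasurable_splice [IsProbabilityMeasure μ] {F : Set (𝒳 → EReal)} (h : SupMeasurable μ F) {k : ℕ}
    (b : Fin k → Bool) : AEMeasurable (fun p => weightedSup F (splitSign k) (splice b p))
      ((Measure.pi fun _ : Fin k => μ).prod (Measure.pi fun _ : Fin k => μ)) :=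
  (h.aemeasurable (splitSign k)).comp_quasiMeasurePreserving
    (measurePreserving_splice b).quasiMeasurePreserving

/-- Symmetrization. -/
lemma lintegral_weightedSup_splitSign_le [IsProbabilityMeasure μ] {F : Set (𝒳 → EReal)} (h : SupMeasurable μ F) (k : ℕ) :
    2 ^ k * ∫⁻ z, weightedSup F (splitSign k) z ∂(Measure.pi fun _ : Fin (k + k) => μ) ≤
      2 * ∑ b : Fin k → Bool,
        ∫⁻ x, weightedSup F (fun i => boolSign (b i)) x ∂(Measure.pi fun _ : Fin k => μ) := by
  set I : (Fin k → Bool) → ℝ≥0∞ := fun b =>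
    ∫⁻ x, weightedSup F (fun i => boolSign (b i)) x ∂(Measure.pi fun _ : Fin k => μ)
  have hb : ∀ b : Fin k → Bool,
      ∫⁻ z, weightedSup F (splitSign k) z ∂(Measure.pi fun _ : Fin (k + k) => μ)
        ≤ I b + I (fun i => !b i) := by
    intro b
    have h1 := h.aemeasurable fun i : Fin k => boolSign (b i)
    have h2 := h.aemeasurable fun i : Fin k => boolSign (!b i)
    rw [← lintegral_comp_of_measurePreserving (measurePreserving_splice b)
      (h.aemeasurable (splitSign k))]
    refine (lintegral_mono fun p => weightedSup_splice_le F b p).trans (le_of_eq ?_)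
    have h1' : AEMeasurable (fun p : (Fin k → 𝒳) × (Fin k → 𝒳) =>
        weightedSup F (fun i => boolSign (b i)) p.1)
        ((Measure.pi fun _ : Fin k => μ).prod (Measure.pi fun _ : Fin k => μ)) :=
      h1.comp_quasiMeasurePreserving measurePreserving_fst.quasiMeasurePreserving
    rw [lintegral_add_left' h1',
      lintegral_comp_of_measurePreserving measurePreserving_fst h1,
      lintegral_comp_of_measurePreserving measurePreserving_snd h2]
  have hinv : ∑ b : Fin k → Bool, I (fun i => !b i) = ∑ b, I b :=
    Equiv.sum_comp (Equiv.piCongrRight fun _ : Fin k => Equiv.boolNot) I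
  calc _ = ∑ _b : Fin k → Bool,
        ∫⁻ z, weightedSup F (splitSign k) z ∂(Measure.pi fun _ : Fin (k + k) => μ) := by simp
    _ ≤ ∑ b : Fin k → Bool, (I b + I (fun i => !b i)) := Finset.sum_le_sum fun b _ => hb b
    _ = _ := by rw [Finset.sum_add_distrib, hinv, two_mul]

/-- This is the case of sample size one and weight one of `SupMeasurable`. -/
lemma SupMeasurable.aemeasurable_envelope [IsProbabilityMeasure μ] {F : Set (𝒳 → EReal)} (h : SupMeasurable μ F) :
    AEMeasurable (envelope F) μ := by
  have hT : MeasurePreserving (fun (x : 𝒳) (_ : Fin 1) => x) μ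
      (Measure.pi fun _ : Fin 1 => μ) := by
    refine ⟨by fun_prop, (Measure.pi_eq fun s hs => ?_).symm⟩
    rw [Measure.map_apply (by fun_prop) (MeasurableSet.univ_pi hs)]
    simp [Set.preimage, Set.mem_pi]
  have := (h.aemeasurable fun _ : Fin 1 => 1).comp_quasiMeasurePreserving hT.quasiMeasurePreserving
  refine this.congr (Eventually.of_forall fun x => ?_)
  simp [weightedSup, envelope]

lemma aemeasurable_envelopeTail {F : Set (𝒳 → EReal)} (h : AEMeasurable (envelope F) μ)
    (M : ℝ≥0) : AEMeasurable (envelopeTail F M) μ := by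
  have hm : Measurable fun t : ℝ≥0∞ => if t ≤ M then 0 else t :=
    Measurable.ite measurableSet_Iic measurable_const measurable_id
  exact hm.comp_aemeasurable h

lemma exists_lintegral_envelopeTail_le {F : Set (𝒳 → EReal)} (h : AEMeasurable (envelope F) μ)
    (henvi : ∫⁻ x, envelope F x ∂μ < ∞) {ε : ℝ≥0∞} (hε : 0 < ε) :
    ∃ M : ℝ≥0, ∫⁻ x, envelopeTail F M x ∂μ ≤ ε := by
  have hlim : Tendsto (fun m : ℕ => ∫⁻ x, envelopeTail F m x ∂μ) atTop (𝓝 (∫⁻ _, 0 ∂μ)) := by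
    refine tendsto_lintegral_of_dominated_convergence' (envelope F)
      (fun m => aemeasurable_envelopeTail h m) (fun m => Eventually.of_forall fun x => ?_)
      henvi.ne ?_
    · simp only [envelopeTail]
      split_ifs
      · exact zero_le
      · exact le_rfl
    · filter_upwards [ae_lt_top' h henvi.ne] with x hx
      obtain ⟨m, hm⟩ := ENNReal.exists_nat_gt hx.ne
      refine tendsto_const_nhds.congr' ?_
      filter_upwards [eventually_ge_atTop m] with j hj
      have : envelope F x ≤ ((j : ℝ≥0) : ℝ≥0∞) := by
        refine hm.le.trans ?_
        simpa using hj
      simp only [envelopeTail, if_pos this]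
  rw [lintegral_zero] at hlim
  obtain ⟨m, hm⟩ := (hlim.eventually (ge_mem_nhds hε)).exists
  exact ⟨m, hm⟩

/-- The mean of the first half of a sample, centred at its expectation, is dominated by a
conditional expectation of the symmetrized supremum. -/
lemma ae_centred_sum_le [IsProbabilityMeasure μ] {F : Set (𝒳 → EReal)} (hF : ∀ f ∈ F, Measurable f)
    (hsup : SupMeasurable μ F) (henvi : ∫⁻ x, envelope F x ∂μ < ∞) (k : ℕ) :
    ∀ᵐ x ∂(Measure.pi fun _ : Fin k => μ), ∀ f ∈ F,
      ENNReal.ofReal |∑ i, (f (x i)).toReal - k * ∫ y, (f y).toReal ∂μ| ≤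
        ∫⁻ x', weightedSup F (splitSign k) (splice (fun _ => true) (x, x'))
          ∂(Measure.pi fun _ : Fin k => μ) := by
  have hfin : ∀ᵐ y ∂μ, envelope F y < ∞ := ae_lt_top' hsup.aemeasurable_envelope henvi.ne
  -- The exceptional null set comes from the envelope alone, so it serves all members of a possibly
  -- uncountable class.
  have hfin' : ∀ᵐ x ∂(Measure.pi fun _ : Fin k => μ), ∀ i, envelope F (x i) < ∞ :=
    ae_all_iff.2 fun i => (measurePreserving_eval (fun _ : Fin k => μ) i).quasiMeasurePreserving.ae
      hfin
  filter_upwards [hfin'] with x hx f hf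
  have hreal : ∀ y, envelope F y < ∞ → f y = ((f y).toReal : EReal) := by
    intro y hy
    have := (abs_le_envelope hf y).trans_lt hy
    refine (EReal.coe_toReal ?_ ?_).symm <;>
    · intro h
      simp [h] at this
  have hfint : Integrable (fun y => (f y).toReal) μ := by
    refine ⟨(hF f hf).ereal_toReal.aestronglyMeasurable, ?_⟩
    refine lt_of_le_of_lt (lintegral_mono_ae ?_) henvi
    filter_upwards [hfin] with y hy
    rw [Real.enorm_eq_ofReal_abs, ← EReal.abs_def, ← hreal y hy]
    exact abs_le_envelope hf y
  have hcoord : ∀ i : Fin k, Integrable (fun x' : Fin k → 𝒳 => (f (x' i)).toReal)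
      (Measure.pi fun _ : Fin k => μ) := fun i =>
    (measurePreserving_eval (fun _ : Fin k => μ) i).integrable_comp_of_integrable hfint
  -- The expectation is rewritten as the mean over an independent ghost sample `x'`.
  have hE : ∑ i, (f (x i)).toReal - k * ∫ y, (f y).toReal ∂μ =
      ∫ x', (∑ i, (f (x i)).toReal - ∑ i, (f (x' i)).toReal)
        ∂(Measure.pi fun _ : Fin k => μ) := by
    rw [integral_sub (integrable_const _) (integrable_finsetSum _ fun i _ => hcoord i),
      integral_finsetSum _ fun i _ => hcoord i]
    have : ∀ i : Fin k, ∫ x', (f (x' i)).toReal ∂(Measure.pi fun _ : Fin k => μ)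
        = ∫ y, (f y).toReal ∂μ := fun i =>
      integral_comp_eval (μ := fun _ : Fin k => μ) (f := fun y => (f y).toReal)
        hfint.aestronglyMeasurable
    simp [this]
  rw [hE, ← Real.enorm_eq_ofReal_abs]
  refine (enorm_integral_le_lintegral_enorm _).trans (lintegral_mono_ae ?_)
  filter_upwards [hfin'] with x' hx'
  refine le_trans (le_of_eq ?_) (le_weightedSup hf _ _)
  rw [Real.enorm_eq_ofReal_abs, ← EReal.abs_def]
  congr 1
  rw [Fin.sum_univ_add, EReal.coe_sub, ereal_coe_sum, ereal_coe_sum, sub_eq_add_neg,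
    ← ereal_coe_sum Finset.univ (fun i => (f (x' i)).toReal), ← EReal.coe_neg,
    ← Finset.sum_neg_distrib, ereal_coe_sum]
  congr 1
  · refine Finset.sum_congr rfl fun i _ => ?_
    simp only [splitSign, splice, Fin.append_left, if_true]
    rw [← hreal _ (hx i), EReal.coe_one, one_mul]
  · refine Finset.sum_congr rfl fun i _ => ?_
    simp only [splitSign, splice, Fin.append_right, if_true]
    rw [EReal.coe_neg, EReal.coe_neg, ← hreal _ (hx' i), EReal.coe_one, EReal.neg_mul, one_mul]

variable {Ω : Type*} [MeasurableSpace Ω] {Pr : Measure Ω}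

lemma IsIIDSample.measurePreserving {Z : ℕ → Ω → 𝒳} (hZ : IsIIDSample Pr μ Z) (i : ℕ) :
    MeasurePreserving (Z i) Pr μ := ⟨hZ.measurable i, hZ.map_eq i⟩

lemma IsIIDSample.measurePreserving_pi [IsProbabilityMeasure Pr] {Z : ℕ → Ω → 𝒳} (hZ : IsIIDSample Pr μ Z) {n : ℕ}
    {g : Fin n → ℕ} (hg : Function.Injective g) :
    MeasurePreserving (fun ω (i : Fin n) => Z (g i) ω) Pr (Measure.pi fun _ : Fin n => μ) := by
  refine ⟨measurable_pi_lambda _ fun i => hZ.measurable _, ?_⟩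
  rw [(iIndepFun_iff_map_fun_eq_pi_map fun i => (hZ.measurable (g i)).aemeasurable).1
    (hZ.indep.precomp hg)]
  simp [hZ.map_eq]

/-- Where the entropy is small the covering bound applies; on the bad event the envelope gives the
crude bound `n * M` plus the tail. The integrals move to `Ω` because the entropy condition is a
statement about `Pr`. -/
lemma sum_lintegral_weightedSup_le [IsProbabilityMeasure μ] [IsProbabilityMeasure Pr]
    {F : Set (𝒳 → EReal)} (hF : F.Nonempty)
    (hsup : SupMeasurable μ F) {Z : ℕ → Ω → 𝒳} (hZ : IsIIDSample Pr μ Z) {n : ℕ} (hn : n ≠ 0)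
    (M δ η : ℝ≥0) {t : ℝ} (ht : 0 < t) :
    ∑ b : Fin n → Bool,
        ∫⁻ x, weightedSup F (fun i => boolSign (b i)) x ∂(Measure.pi fun _ : Fin n => μ) ≤
      2 ^ n * (ENNReal.ofReal
          (Real.log (2 * Real.exp (n * η)) / t + n * (t * M ^ 2 / 2) + n * δ)
        + n * M * Pr {ω | (η : ℝ≥0∞) ≤ metricEntropy δ F (fun i : Fin n => Z i ω) / (n : ℝ≥0∞)}
        + n * ∫⁻ x, envelopeTail F M x ∂μ) := by
  set bad : Set Ω := {ω | (η : ℝ≥0∞) ≤ metricEntropy δ F (fun i : Fin n => Z i ω) / (n : ℝ≥0∞)}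
  set A : ℝ≥0∞ := ENNReal.ofReal
    (Real.log (2 * Real.exp (n * η)) / t + n * (t * M ^ 2 / 2) + n * δ)
  have hmp := hZ.measurePreserving_pi (n := n) (g := fun i => (i : ℕ)) Fin.val_injective
  have htail := aemeasurable_envelopeTail hsup.aemeasurable_envelope M
  have htailZ : ∀ i : Fin n, AEMeasurable (fun ω => envelopeTail F M (Z i ω)) Pr := fun i =>
    htail.comp_quasiMeasurePreserving (hZ.measurePreserving i).quasiMeasurePreserving
  -- The entropy need not be measurable, so the bad event enters through its measurable hull, which
  -- has the same outer probability.
  have hpt : ∀ ω, ∑ b : Fin n → Bool,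
      weightedSup F (fun i => boolSign (b i)) (fun i => Z i ω) ≤
      2 ^ n * (A + n * M * (toMeasurable Pr bad).indicator 1 ω
        + ∑ i : Fin n, envelopeTail F M (Z i ω)) := by
    intro ω
    by_cases hω : ω ∈ bad
    · have hω' : ω ∈ toMeasurable Pr bad := subset_toMeasurable _ _ hω
      calc _ ≤ ∑ _b : Fin n → Bool, ∑ i : Fin n, (M + envelopeTail F M (Z i ω)) := by
            refine Finset.sum_le_sum fun b _ => (weightedSup_boolSign_le F b _).trans ?_
            exact Finset.sum_le_sum fun i _ => envelope_le_add_tail F M _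
        _ = 2 ^ n * (n * M + ∑ i : Fin n, envelopeTail F M (Z i ω)) := by
            simp [Finset.sum_add_distrib, mul_add]
        _ ≤ _ := by
            rw [Set.indicator_of_mem hω', Pi.one_apply, mul_one]
            gcongr
            exact le_add_self
    · obtain ⟨C, hcard, hC⟩ := exists_cover_of_metricEntropy_lt hF hn
        (fun i : Fin n => Z i ω) δ η (not_le.1 hω)
      refine (sum_weightedSup_le_of_cover hF hn (fun i : Fin n => Z i ω) M δ (Real.exp_pos _) ht
        C hcard hC).trans ?_
      gcongr
      exact le_self_add
  calc ∑ b : Fin n → Bool,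
        ∫⁻ x, weightedSup F (fun i => boolSign (b i)) x ∂(Measure.pi fun _ : Fin n => μ)
      = ∑ b : Fin n → Bool,
        ∫⁻ ω, weightedSup F (fun i => boolSign (b i)) (fun i => Z i ω) ∂Pr := by
        refine Finset.sum_congr rfl fun b _ => ?_
        rw [lintegral_comp_of_measurePreserving hmp (hsup.aemeasurable _)]
    _ = ∫⁻ ω, ∑ b : Fin n → Bool,
        weightedSup F (fun i => boolSign (b i)) (fun i => Z i ω) ∂Pr := by
        rw [lintegral_finsetSum']
        intro b _
        exact (hsup.aemeasurable _).comp_quasiMeasurePreserving hmp.quasiMeasurePreserving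
    _ ≤ ∫⁻ ω, 2 ^ n * (A + n * M * (toMeasurable Pr bad).indicator 1 ω
        + ∑ i : Fin n, envelopeTail F M (Z i ω)) ∂Pr := lintegral_mono hpt
    _ = _ := by
        have hind : Measurable ((toMeasurable Pr bad).indicator (1 : Ω → ℝ≥0∞)) :=
          measurable_one.indicator (measurableSet_toMeasurable _ _)
        rw [lintegral_const_mul' _ _ (by simp), lintegral_add_left (by fun_prop),
          lintegral_add_left measurable_const, lintegral_const, measure_univ, mul_one,
          lintegral_const_mul _ hind, lintegral_indicator_one (measurableSet_toMeasurable _ _),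
          measure_toMeasurable, lintegral_finsetSum' _ fun i _ => htailZ i]
        have : ∀ i : Fin n, ∫⁻ ω, envelopeTail F M (Z i ω) ∂Pr = ∫⁻ x, envelopeTail F M x ∂μ :=
          fun i => lintegral_comp_of_measurePreserving (hZ.measurePreserving i) htail
        simp [this]

/-- The symmetrized empirical process vanishes in mean. -/
lemma eventually_lintegral_weightedSup_le [IsProbabilityMeasure μ] [IsProbabilityMeasure Pr]
    {F : Set (𝒳 → EReal)} (hF : F.Nonempty)
    (hsup : SupMeasurable μ F) (henvi : ∫⁻ x, envelope F x ∂μ < ∞) {Z : ℕ → Ω → 𝒳}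
    (hZ : IsIIDSample Pr μ Z) (hent : EntropyCondition Pr Z F) {ε : ℝ≥0} (hε : 0 < ε) :
    ∀ᶠ k : ℕ in atTop,
      ∫⁻ z, weightedSup F (splitSign k) z ∂(Measure.pi fun _ : Fin (k + k) => μ) ≤ k * ε := by
  -- The budget: four terms of size `n * r` from the covering bound, one from the bad event and one
  -- from the tail, doubled by symmetrization.
  set r : ℝ≥0 := ε / 12 with hr
  have hrpos : 0 < r := by positivity
  obtain ⟨M, hM⟩ := exists_lintegral_envelopeTail_le hsup.aemeasurable_envelope henvi
    (ε := r) (by exact_mod_cast hrpos)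
  -- This makes the variance term `t * M ^ 2 / 2` at most `r`; the entropy level `r * t` below then
  -- contributes exactly `n * r` after division by `t`.
  set t : ℝ≥0 := r / (M ^ 2 + 1) with ht
  have htpos : 0 < t := by positivity
  have hbad := (hent r hrpos (r * t : ℝ≥0) (by exact_mod_cast mul_pos hrpos htpos)).eventually
    (ge_mem_nhds (show (0 : ℝ≥0∞) < (r / (M + 1) : ℝ≥0) by
      exact_mod_cast (by positivity : 0 < r / (M + 1))))
  filter_upwards [hbad, eventually_ne_atTop 0,
    eventually_ge_atTop ⌈Real.log 2 / (t * r)⌉₊] with n hn hn0 hnlog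
  have hsum := sum_lintegral_weightedSup_le hF hsup hZ hn0 M r (r * t) (t := t) htpos
  have hA : Real.log (2 * Real.exp (n * (r * t : ℝ≥0))) / t + n * (t * M ^ 2 / 2) + n * r
      ≤ n * (4 * r) := by
    have htR : (0 : ℝ) < t := htpos
    have hrR : (0 : ℝ) < r := hrpos
    rw [Real.log_mul (by norm_num) (Real.exp_pos _).ne', Real.log_exp, add_div]
    have h1 : Real.log 2 / t ≤ n * r := by
      have := Nat.ceil_le.1 hnlog
      rw [div_le_iff₀ (by positivity)] at this
      rw [div_le_iff₀ htR]
      linarith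
    have h2 : n * ((r * t : ℝ≥0) : ℝ) / t = n * r := by
      push_cast; field_simp
    have h3 : (t : ℝ) * M ^ 2 / 2 ≤ r := by
      have : (t : ℝ) * (M ^ 2 + 1) = r := by
        rw [ht]; push_cast; field_simp
      nlinarith [sq_nonneg (M : ℝ)]
    have h4 : (n : ℝ) * (t * M ^ 2 / 2) ≤ n * r := by gcongr
    linarith
  have hbadn : (n * M : ℝ≥0∞) * Pr {ω | ((r * t : ℝ≥0) : ℝ≥0∞) ≤
      metricEntropy r F (fun i : Fin n => Z i ω) / (n : ℝ≥0∞)} ≤ n * r := by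
    have : M * (r / (M + 1)) ≤ r := by
      rw [← mul_div_assoc, div_le_iff₀ (by positivity), mul_comm]
      gcongr
      exact le_self_add
    calc _ ≤ (n * M : ℝ≥0∞) * (r / (M + 1) : ℝ≥0) := by gcongr
      _ = n * ((M * (r / (M + 1)) : ℝ≥0) : ℝ≥0∞) := by push_cast; ring
      _ ≤ n * r := by gcongr
  have hAE : ENNReal.ofReal (Real.log (2 * Real.exp (n * (r * t : ℝ≥0))) / t
      + n * (t * M ^ 2 / 2) + n * r) ≤ n * (4 * r) := by
    refine (ENNReal.ofReal_le_ofReal hA).trans (le_of_eq ?_)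
    rw [ENNReal.ofReal_mul (by positivity), ENNReal.ofReal_mul (by positivity)]
    simp
  have htot : 2 ^ n * ∫⁻ z, weightedSup F (splitSign n) z ∂(Measure.pi fun _ : Fin (n + n) => μ)
      ≤ 2 ^ n * (n * ε) := by
    calc _ ≤ _ := lintegral_weightedSup_splitSign_le hsup n
      _ ≤ 2 * (2 ^ n * (n * (4 * r) + n * r + n * r)) := by
          gcongr
          exact hsum.trans (by gcongr)
      _ = 2 ^ n * (n * ((12 * r : ℝ≥0) : ℝ≥0∞)) := by push_cast; ring
      _ = _ := by rw [hr, mul_div_cancel₀ _ (by norm_num)]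
  rwa [ENNReal.mul_le_mul_iff_right (by simp) (by simp)] at htot

end KLEstimation

end

/-! ### From one block length to the uniform strong law. -/

noncomputable section

namespace KLEstimation

variable {𝒳 Ω : Type*} [MeasurableSpace 𝒳] [MeasurableSpace Ω] {μ : Measure 𝒳} {Pr : Measure Ω}

lemma block_injective (k j : ℕ) : Function.Injective fun i : Fin k => j * k + (i : ℕ) :=
  fun a b h => Fin.ext (by simpa using h)

/-- The strong law of large numbers for a function of disjoint blocks of length `k`. -/
lemma strong_law_ae_block [IsProbabilityMeasure Pr] {Z : ℕ → Ω → 𝒳} (hZ : IsIIDSample Pr μ Z)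
    {k : ℕ} {g : (Fin k → 𝒳) → ℝ} (hg : Measurable g)
    (hgi : Integrable g (Measure.pi fun _ : Fin k => μ)) :
    ∀ᵐ ω ∂Pr, Tendsto
      (fun q : ℕ => (q : ℝ)⁻¹ * ∑ j ∈ Finset.range q, g (fun i => Z (j * k + i) ω)) atTop
      (𝓝 (∫ x, g x ∂(Measure.pi fun _ : Fin k => μ))) := by
  have hmp : ∀ j : ℕ, MeasurePreserving (fun ω (i : Fin k) => Z (j * k + i) ω) Pr
      (Measure.pi fun _ : Fin k => μ) := fun j =>
    hZ.measurePreserving_pi (block_injective k j)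
  have hindep : Pairwise (Function.onFun (IndepFun · · Pr)
      fun (j : ℕ) ω => g (fun i : Fin k => Z (j * k + i) ω)) := by
    intro j j' hjj
    have hdisj : Disjoint (Finset.Ico (j * k) (j * k + k)) (Finset.Ico (j' * k) (j' * k + k)) := by
      rw [Finset.disjoint_left]
      intro a ha hb
      rw [Finset.mem_Ico] at ha hb
      rcases lt_or_gt_of_ne hjj with h | h
      · have := Nat.mul_le_mul_right k (Nat.succ_le_of_lt h)
        rw [Nat.succ_mul] at this
        omega
      · have := Nat.mul_le_mul_right k (Nat.succ_le_of_lt h)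
        rw [Nat.succ_mul] at this
        omega
    have hφ : ∀ l : ℕ, Measurable fun v : Finset.Ico (l * k) (l * k + k) → 𝒳 =>
        g fun i : Fin k => v ⟨l * k + i, Finset.mem_Ico.2 ⟨by omega, by omega⟩⟩ := fun l =>
      hg.comp (by fun_prop)
    exact (hZ.indep.indepFun_finset _ _ hdisj hZ.measurable).comp (hφ j) (hφ j')
  have hident : ∀ j : ℕ, IdentDistrib (fun ω => g (fun i : Fin k => Z (j * k + i) ω))
      (fun ω => g (fun i : Fin k => Z (0 * k + i) ω)) Pr Pr := fun j =>
    IdentDistrib.comp ⟨(hmp j).measurable.aemeasurable, (hmp 0).measurable.aemeasurable,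
      by rw [(hmp j).map_eq, (hmp 0).map_eq]⟩ hg
  have hmean : ∫ ω, g (fun i : Fin k => Z (0 * k + i) ω) ∂Pr =
      ∫ x, g x ∂(Measure.pi fun _ : Fin k => μ) := by
    rw [← (hmp 0).map_eq, integral_map (hmp 0).measurable.aemeasurable
      hg.aestronglyMeasurable]
  have := strong_law_ae (fun (j : ℕ) ω => g (fun i : Fin k => Z (j * k + i) ω))
    ((hmp 0).integrable_comp_of_integrable hgi) hindep hident
  rw [hmean] at this
  simpa only [smul_eq_mul] using this

lemma eventually_sum_range_le {a : ℕ → ℝ} {m : ℝ}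
    (h : Tendsto (fun q : ℕ => (q : ℝ)⁻¹ * ∑ j ∈ Finset.range q, a j) atTop (𝓝 m)) {η : ℝ}
    (hη : 0 < η) : ∀ᶠ q : ℕ in atTop, |∑ j ∈ Finset.range q, a j - q * m| ≤ q * η := by
  filter_upwards [(Metric.tendsto_nhds.1 h) η hη, eventually_gt_atTop 0] with q hq hq0
  have hq' : (0 : ℝ) < q := by exact_mod_cast hq0
  rw [Real.dist_eq] at hq
  have e : ∑ j ∈ Finset.range q, a j - q * m
      = q * ((q : ℝ)⁻¹ * ∑ j ∈ Finset.range q, a j - m) := by field_simp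
  rw [e, abs_mul, abs_of_pos hq']
  gcongr

/-- A term is the difference of consecutive partial sums, hence `o(q)`. This controls the incomplete
last block. -/
lemma eventually_term_le {a : ℕ → ℝ} {m : ℝ}
    (h : Tendsto (fun q : ℕ => (q : ℝ)⁻¹ * ∑ j ∈ Finset.range q, a j) atTop (𝓝 m)) {η : ℝ}
    (hη : 0 < η) : ∀ᶠ q : ℕ in atTop, a q ≤ q * η := by
  have h1 := eventually_sum_range_le h (η := η / 4) (by positivity)
  filter_upwards [h1, (tendsto_add_atTop_nat 1).eventually h1,
    eventually_ge_atTop ⌈2 * (m + η) / η⌉₊] with q hq hq1 hqm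
  rw [Finset.sum_range_succ, abs_le] at hq1
  rw [abs_le] at hq
  push_cast at hq1
  have := Nat.ceil_le.1 hqm
  rw [div_le_iff₀ hη] at this
  nlinarith [hq.1, hq1.2]

lemma sum_range_block (a : ℕ → ℝ) (k q : ℕ) :
    ∑ i ∈ Finset.range (q * k), a i = ∑ j ∈ Finset.range q, ∑ i : Fin k, a (j * k + i) := by
  induction q with
  | zero => simp
  | succ q ih =>
    rw [Nat.succ_mul, Finset.sum_range_add, ih, Finset.sum_range_succ,
      Finset.sum_range fun i => a (q * k + i)]

/-- Domination on blocks of one fixed length controls the averages along the whole sequence. -/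
lemma ae_eventually_abs_sum_le_of_block [IsProbabilityMeasure μ] [IsProbabilityMeasure Pr]
    {Z : ℕ → Ω → 𝒳} (hZ : IsIIDSample Pr μ Z) {ι : Type*} (ψ : ι → 𝒳 → ℝ) {H : 𝒳 → ℝ}
    (hHm : Measurable H) (hHi : Integrable H μ) (hH : ∀ᵐ y ∂μ, ∀ f, |ψ f y| ≤ H y) {k : ℕ}
    (hk : 0 < k) {u : (Fin k → 𝒳) → ℝ} (hu : Measurable u)
    (hui : Integrable u (Measure.pi fun _ : Fin k => μ))
    (hub : ∀ᵐ x ∂(Measure.pi fun _ : Fin k => μ), ∀ f, |∑ i, ψ f (x i)| ≤ u x) {ε : ℝ}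
    (hε : 0 < ε) (hmean : ∫ x, u x ∂(Measure.pi fun _ : Fin k => μ) ≤ k * ε) :
    ∀ᵐ ω ∂Pr, ∀ᶠ n : ℕ in atTop, ∀ f, |∑ i ∈ Finset.range n, ψ f (Z i ω)| ≤ 3 * ε * n := by
  have hcoord : ∀ i : Fin k, Integrable (fun x : Fin k → 𝒳 => H (x i))
      (Measure.pi fun _ : Fin k => μ) := fun i =>
    (measurePreserving_eval (fun _ : Fin k => μ) i).integrable_comp_of_integrable hHi
  have hsH := strong_law_ae_block hZ (k := k) (g := fun x => ∑ i, H (x i)) (by fun_prop)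
    (integrable_finsetSum _ fun i _ => hcoord i)
  have hHZ : ∀ᵐ ω ∂Pr, ∀ i, ∀ f, |ψ f (Z i ω)| ≤ H (Z i ω) := ae_all_iff.2 fun i =>
    (hZ.measurePreserving i).quasiMeasurePreserving.ae hH
  have hubZ : ∀ᵐ ω ∂Pr, ∀ j : ℕ, ∀ f,
      |∑ i : Fin k, ψ f (Z (j * k + i) ω)| ≤ u (fun i => Z (j * k + i) ω) := ae_all_iff.2 fun j =>
    (hZ.measurePreserving_pi (block_injective k j)).quasiMeasurePreserving.ae hub
  filter_upwards [hsH, strong_law_ae_block hZ hu hui, hHZ, hubZ] with ω h1 h2 h3 h4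
  have hkR : (0 : ℝ) < k := by exact_mod_cast hk
  have e1 := eventually_term_le h1 (η := k * ε) (by positivity)
  have e2 := eventually_sum_range_le h2 (η := k * ε) (by positivity)
  have hq : Tendsto (fun n : ℕ => n / k) atTop atTop := Nat.tendsto_div_const_atTop hk.ne'
  filter_upwards [hq.eventually e1, hq.eventually e2] with n hn1 hn2 f
  set q := n / k
  have hn : n = q * k + n % k := by rw [mul_comm]; exact (Nat.div_add_mod n k).symm
  have hmod : n % k ≤ k := (Nat.mod_lt n hk).le
  have hmain : |∑ i ∈ Finset.range (q * k), ψ f (Z i ω)|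
      ≤ ∑ j ∈ Finset.range q, u (fun i => Z (j * k + i) ω) := by
    rw [sum_range_block (fun i => ψ f (Z i ω))]
    exact (Finset.abs_sum_le_sum_abs _ _).trans (Finset.sum_le_sum fun j _ => h4 j f)
  have hrem : |∑ i ∈ Finset.range (n % k), ψ f (Z (q * k + i) ω)|
      ≤ ∑ i : Fin k, H (Z (q * k + i) ω) := by
    refine (Finset.abs_sum_le_sum_abs _ _).trans ?_
    rw [← Finset.sum_range fun i => H (Z (q * k + i) ω)]
    refine (Finset.sum_le_sum fun i _ => h3 _ f).trans
      (Finset.sum_le_sum_of_subset_of_nonneg (Finset.range_mono hmod) fun i _ _ => ?_)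
    exact (abs_nonneg _).trans (h3 _ f)
  have hsplit : ∑ i ∈ Finset.range n, ψ f (Z i ω) = ∑ i ∈ Finset.range (q * k), ψ f (Z i ω)
      + ∑ i ∈ Finset.range (n % k), ψ f (Z (q * k + i) ω) := by
    conv_lhs => rw [hn]
    rw [Finset.sum_range_add]
  have hqn : (q : ℝ) * k ≤ n := by exact_mod_cast Nat.div_mul_le_self n k
  have hum : (q : ℝ) * ∫ x, u x ∂(Measure.pi fun _ : Fin k => μ) ≤ q * (k * ε) := by gcongr
  rw [hsplit]
  -- The factor `3` collects the mean of `u`, its fluctuation and the incomplete block, each at most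
  -- `q * k * ε`, where `q * k ≤ n`.
  refine (abs_add_le _ _).trans ?_
  have := (abs_le.1 hn2).2
  nlinarith [mul_le_mul_of_nonneg_right hqn hε.le]

/-- The uniform strong law of large numbers under a random entropy condition. -/
theorem ae_eventually_uniform_sum_le [IsProbabilityMeasure μ] [IsProbabilityMeasure Pr]
    {F : Set (𝒳 → EReal)} (hne : F.Nonempty) (hF : ∀ f ∈ F, Measurable f)
    (hsup : SupMeasurable μ F) (henvi : ∫⁻ x, envelope F x ∂μ < ∞) {Z : ℕ → Ω → 𝒳}
    (hZ : IsIIDSample Pr μ Z) (hent : EntropyCondition Pr Z F) :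
    ∀ᵐ ω ∂Pr, ∀ ε : ℝ, 0 < ε → ∀ᶠ n : ℕ in atTop, ∀ f ∈ F,
      |∑ i : Fin n, (f (Z i ω)).toReal - n * ∫ y, (f y).toReal ∂μ| ≤ ε * n := by
  have henv := hsup.aemeasurable_envelope
  set c : ℝ := (∫⁻ x, envelope F x ∂μ).toReal
  have hEi : Integrable (fun y => (henv.mk _ y).toReal) μ :=
    integrable_toReal_of_lintegral_ne_top henv.measurable_mk.aemeasurable
      (by rw [← lintegral_congr_ae henv.ae_eq_mk]; exact henvi.ne)
  have habs : ∀ f ∈ F, ∀ y, ENNReal.ofReal |(f y).toReal| ≤ envelope F y :=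
    fun f hf y => (ofReal_abs_toReal_le _).trans (abs_le_envelope hf y)
  have hH : ∀ᵐ y ∂μ, ∀ f : F, |((f : 𝒳 → EReal) y).toReal - ∫ z, ((f : 𝒳 → EReal) z).toReal ∂μ| ≤
      (henv.mk _ y).toReal + c := by
    filter_upwards [henv.ae_eq_mk, ae_lt_top' henv henvi.ne] with y hy hylt f
    refine (abs_sub _ _).trans (add_le_add ?_ ?_)
    · rw [← hy]
      exact (ENNReal.ofReal_le_iff_le_toReal hylt.ne).1 (habs f f.2 y)
    · refine (ENNReal.ofReal_le_iff_le_toReal henvi.ne).1 ?_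
      rw [← Real.enorm_eq_ofReal_abs]
      refine (enorm_integral_le_lintegral_enorm _).trans (lintegral_mono fun z => ?_)
      rw [Real.enorm_eq_ofReal_abs]
      exact habs f f.2 z
  -- Countably many tolerances keep the union of the exceptional sets null. The block length may
  -- depend on `m`.
  have key : ∀ m : ℕ, ∀ᵐ ω ∂Pr, ∀ᶠ n : ℕ in atTop, ∀ f : F,
      |∑ i ∈ Finset.range n, (((f : 𝒳 → EReal) (Z i ω)).toReal
        - ∫ z, ((f : 𝒳 → EReal) z).toReal ∂μ)| ≤ 3 * (1 / ((m : ℝ) + 1)) * n := by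
    intro m
    have hpos : (0 : ℝ) < 1 / ((m : ℝ) + 1) := by positivity
    obtain ⟨k, hk, hk0⟩ := ((eventually_lintegral_weightedSup_le hne hsup henvi hZ hent
      (ε := (1 / ((m : ℝ) + 1)).toNNReal) (Real.toNNReal_pos.2 hpos)).and (eventually_gt_atTop 0)).exists
    have hspl := hsup.aemeasurable_splice fun _ : Fin k => true
    -- The ghost half is integrated out. A measurable version of the result serves as the dominating
    -- block function `u`.
    have hU := hspl.lintegral_prod_right'
    have hUint : ∫⁻ x, ∫⁻ x', weightedSup F (splitSign k) (splice (fun _ => true) (x, x'))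
        ∂(Measure.pi fun _ : Fin k => μ) ∂(Measure.pi fun _ : Fin k => μ)
        ≤ k * ENNReal.ofReal (1 / ((m : ℝ) + 1)) := by
      rw [← lintegral_prod _ hspl, lintegral_comp_of_measurePreserving (measurePreserving_splice _)
        (hsup.aemeasurable (splitSign k))]
      exact hk
    have hUfin := hUint.trans_lt (ENNReal.mul_lt_top (by simp) ENNReal.ofReal_lt_top)
    have hmk : ∫⁻ x, hU.mk _ x ∂(Measure.pi fun _ : Fin k => μ) ≤
        k * ENNReal.ofReal (1 / ((m : ℝ) + 1)) := by
      rwa [← lintegral_congr_ae hU.ae_eq_mk]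
    refine ae_eventually_abs_sum_le_of_block hZ
      (fun (f : F) y => ((f : 𝒳 → EReal) y).toReal - ∫ z, ((f : 𝒳 → EReal) z).toReal ∂μ)
      (henv.measurable_mk.ennreal_toReal.add_const c) (hEi.add (integrable_const c)) hH hk0
      (u := fun x => (hU.mk _ x).toReal) hU.measurable_mk.ennreal_toReal
      (integrable_toReal_of_lintegral_ne_top hU.measurable_mk.aemeasurable
        (hmk.trans_lt (ENNReal.mul_lt_top (by simp) ENNReal.ofReal_lt_top)).ne) ?_ hpos ?_
    · filter_upwards [ae_centred_sum_le hF hsup henvi k, hU.ae_eq_mk, ae_lt_top' hU hUfin.ne]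
        with x hx hxmk hxlt f
      have h1 := (ENNReal.ofReal_le_iff_le_toReal hxlt.ne).1 (hx f f.2)
      rw [hxmk] at h1
      simpa using h1
    · rw [integral_toReal hU.measurable_mk.aemeasurable]
      · refine ENNReal.toReal_le_of_le_ofReal (by positivity) (hmk.trans (le_of_eq ?_))
        rw [ENNReal.ofReal_mul (by positivity)]
        simp
      · exact ae_lt_top hU.measurable_mk
          (hmk.trans_lt (ENNReal.mul_lt_top (by simp) ENNReal.ofReal_lt_top)).ne
  filter_upwards [ae_all_iff.2 key] with ω hω ε hε
  obtain ⟨m, hm⟩ := exists_nat_one_div_lt (show 0 < ε / 3 by positivity)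
  filter_upwards [hω m] with n hn f hf
  have := hn ⟨f, hf⟩
  rw [Finset.sum_sub_distrib, Finset.sum_range] at this
  simp only [Finset.sum_const, Finset.card_range, nsmul_eq_mul] at this
  refine this.trans ?_
  gcongr
  linarith

end KLEstimation

end

/-! ### The criterion and pointwise inequalities. -/

noncomputable section

namespace KLEstimation

variable {𝒳 Ω : Type*}

lemma elog_of_pos {t : ℝ} (ht : 0 < t) : elog t = (Real.log t : EReal) :=
  ENNReal.log_ofReal_of_pos ht

lemma elog_of_nonpos {t : ℝ} (ht : t ≤ 0) : elog t = ⊥ := by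
  rw [elog, ENNReal.ofReal_of_nonpos ht, ENNReal.log_zero]

lemma toReal_elog {t : ℝ} (ht : 0 ≤ t) : (elog t).toReal = Real.log t := by
  rcases ht.eq_or_lt with rfl | h
  · simp [elog_of_nonpos le_rfl]
  · rw [elog_of_pos h, EReal.toReal_coe]

lemma measurable_elog : Measurable elog :=
  ENNReal.measurable_log.comp ENNReal.measurable_ofReal

lemma criterion_of_pos {n : ℕ} {x y : Fin n → 𝒳} {g : 𝒳 → ℝ} (hg : ∀ i, 0 < g (x i)) :
    criterion x y g =
      (((∑ i, Real.log (g (x i))) / n - (∑ i, g (y i)) / n : ℝ) : EReal) := by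
  rw [criterion, empMean, empMean, EReal.coe_sub, EReal.coe_div, EReal.coe_div, ereal_coe_sum,
    ereal_coe_sum, EReal.coe_coe_eq_natCast]
  simp only [elog_of_pos (hg _)]

lemma pos_of_criterion_ne_bot {n : ℕ} {x y : Fin n → 𝒳} {g : 𝒳 → ℝ} (hn : n ≠ 0)
    (h : criterion x y g ≠ ⊥) (i : Fin n) : 0 < g (x i) := by
  by_contra! hi
  apply h
  have hsum : ∑ i, elog (g (x i)) = ⊥ := by
    rw [← Finset.add_sum_erase _ _ (Finset.mem_univ i), elog_of_nonpos hi, EReal.bot_add]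
  have hn' : (0 : EReal) < (n : EReal) := by exact_mod_cast Nat.pos_of_ne_zero hn
  rw [criterion, empMean, hsum, EReal.bot_div_of_pos_ne_top hn' (EReal.natCast_ne_top n),
    EReal.bot_sub]

/-- The competitor `gs` has a real criterion, so `g` cannot have criterion `-∞` and must be positive
at every `x i`; the comparison then takes place in `ℝ`. -/
lemma pos_and_loglik_nonneg {n : ℕ} (hn : n ≠ 0) {x y : Fin n → 𝒳} {g₀ gs g : 𝒳 → ℝ}
    (hpos : ∀ i, 0 < g₀ (x i)) (hx : ∀ i, gs (x i) = g₀ (x i)) (hy : ∀ i, gs (y i) = g₀ (y i))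
    (hle : criterion x y gs ≤ criterion x y g) :
    (∀ i, 0 < g (x i)) ∧
      0 ≤ ∑ i, Real.log (g (x i) / g₀ (x i)) - ∑ i, (g (y i) - g₀ (y i)) := by
  rw [criterion_of_pos fun i => by rw [hx]; exact hpos i] at hle
  have hg : ∀ i, 0 < g (x i) := pos_of_criterion_ne_bot (y := y) hn fun h => by
    rw [h, le_bot_iff] at hle
    exact EReal.coe_ne_bot _ hle
  refine ⟨hg, ?_⟩
  rw [criterion_of_pos hg, EReal.coe_le_coe_iff, ← sub_div, ← sub_div,
    div_le_div_iff_of_pos_right (by exact_mod_cast Nat.pos_of_ne_zero hn)] at hle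
  simp only [hx, hy] at hle
  simp only [Real.log_div (hg _).ne' (hpos _).ne', Finset.sum_sub_distrib]
  linarith

/-- This separates the part depending on `g`, which will be squeezed to zero, from plain averages of
`log g₀` and `g₀`. -/
lemma klEstimate_of_pos {n : ℕ} {x y : Fin n → 𝒳} {g₀ g : 𝒳 → ℝ}
    (hpos : ∀ i, 0 < g₀ (x i)) (hg : ∀ i, 0 < g (x i)) :
    klEstimate x y g =
      (((∑ i, Real.log (g (x i) / g₀ (x i)) - ∑ i, (g (y i) - g₀ (y i))) / n
        + (∑ i, Real.log (g₀ (x i))) / n - (∑ i, g₀ (y i)) / n + 1 : ℝ) : EReal) := by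
  rw [klEstimate, criterion_of_pos hg, ← EReal.coe_one, ← EReal.coe_add]
  congr 1
  simp only [Real.log_div (hg _).ne' (hpos _).ne', Finset.sum_sub_distrib]
  ring

lemma log_le_two_mul_sqrt_sub_one {t : ℝ} (ht : 0 < t) : Real.log t ≤ 2 * (√t - 1) := by
  have h := Real.log_le_sub_one_of_pos (Real.sqrt_pos.2 ht)
  rw [Real.log_sqrt ht.le] at h
  linarith

/-- Multiplying `log t ≤ 2(√t - 1)` at `t = b/a` by `a` gives `2√(ab) - 2a`, which is the right
side. The hypothesis `h` excludes `b = 0 < a`, where the convention `Real.log 0 = 0` would make the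
claim false. -/
lemma mul_log_div_le {a b : ℝ} (ha : 0 ≤ a) (hb : 0 ≤ b) (h : a ≠ 0 → 0 < b) :
    a * Real.log (b / a) ≤ b - a - (√a - √b) ^ 2 := by
  rcases ha.eq_or_lt with rfl | ha'
  · simp [Real.sq_sqrt hb]
  · have hb' := h ha'.ne'
    have h1 := mul_le_mul_of_nonneg_left (log_le_two_mul_sqrt_sub_one (div_pos hb' ha')) ha
    have h2 : a * √(b / a) = √a * √b := by
      rw [Real.sqrt_div hb]
      have : √a ≠ 0 := (Real.sqrt_pos.2 ha').ne'
      field_simp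
      rw [Real.sq_sqrt ha]
    nlinarith [Real.sq_sqrt ha, Real.sq_sqrt hb]

/-- With `s = √a`, `t = √b` and `m` the root of the midpoint, `(s - t)(s + t) = 2(s - m)(s + m)`,
and `m ≤ s + t` gives `s + m ≤ 2(s + t)`. Cancelling `s + t` leaves `|s - t| ≤ 4|s - m|`. -/
lemma sq_sqrt_sub_sqrt_le_midpoint {a b : ℝ} (ha : 0 ≤ a) (hb : 0 ≤ b) :
    (√a - √b) ^ 2 ≤ 16 * (√a - √((b + a) / 2)) ^ 2 := by
  set s := √a
  set t := √b
  set m := √((b + a) / 2)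
  have hs : 0 ≤ s := Real.sqrt_nonneg _
  have ht : 0 ≤ t := Real.sqrt_nonneg _
  have hm : 0 ≤ m := Real.sqrt_nonneg _
  have hs2 : s ^ 2 = a := Real.sq_sqrt ha
  have ht2 : t ^ 2 = b := Real.sq_sqrt hb
  have hm2 : m ^ 2 = (b + a) / 2 := Real.sq_sqrt (by positivity)
  have hmst : m ≤ s + t := by
    refine abs_le_of_sq_le_sq' ?_ (by positivity) |>.2
    nlinarith [mul_nonneg hs ht]
  have hle : m + s ≤ 2 * (s + t) := by linarith
  have hprod : 2 * ((s - m) * (m + s)) = (s - t) * (s + t) := by nlinarith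
  rcases (add_nonneg hs ht).eq_or_lt with h0 | hpos
  · have : s - t = 0 := by linarith
    rw [this, zero_pow two_ne_zero]
    exact mul_nonneg (by norm_num) (sq_nonneg _)
  · have h1 : ((s - t) * (s + t)) ^ 2 ≤ (4 * (s - m) * (s + t)) ^ 2 := by
      rw [← hprod]
      have h2 : (m + s) ^ 2 ≤ (2 * (s + t)) ^ 2 := pow_le_pow_left₀ (by positivity) hle 2
      nlinarith [mul_le_mul_of_nonneg_left h2 (sq_nonneg (s - m))]
    rw [mul_pow, mul_pow _ (s + t)] at h1
    have := le_of_mul_le_mul_right h1 (by positivity)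
    linarith [this, mul_pow 4 (s - m) 2]

lemma ofReal_le_envelope_classG {G : Set (𝒳 → ℝ)} {g : 𝒳 → ℝ} (hg : g ∈ G) (x : 𝒳) :
    ENNReal.ofReal (g x) ≤ envelope (classG G) x := by
  refine le_trans ?_ (abs_le_envelope (Set.mem_image_of_mem _ hg) x)
  rw [EReal.abs_def]
  exact ENNReal.ofReal_le_ofReal (le_abs_self _)

/-! ### Densities, expected log-likelihood and envelopes. -/

variable [MeasurableSpace 𝒳] [MeasurableSpace Ω]

/-- The set `{q₀ = 0}` is `Q`-null, hence `P`-null, so `p₀` vanishes `ν`-almost everywhere on it and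
`p₀ = q₀ * g₀` holds there despite division by zero. -/
lemma eq_withDensity_ratio {ν P Q : Measure 𝒳} {p₀ q₀ g₀ : 𝒳 → ℝ} (hp₀ : Measurable p₀)
    (hq₀ : Measurable q₀) (hq₀_nonneg : ∀ x, 0 ≤ q₀ x)
    (hP : P = ν.withDensity fun x => ENNReal.ofReal (p₀ x))
    (hQ : Q = ν.withDensity fun x => ENNReal.ofReal (q₀ x))
    (hg₀ : ∀ x, g₀ x = p₀ x / q₀ x) (hPQ : P ≪ Q) :
    P = Q.withDensity fun x => ENNReal.ofReal (g₀ x) := by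
  have hg₀m : Measurable g₀ := by
    have : g₀ = fun x => p₀ x / q₀ x := funext hg₀
    rw [this]
    exact hp₀.div hq₀
  have hQ0 : Q {x | q₀ x = 0} = 0 := by
    rw [hQ, withDensity_apply_eq_zero hq₀.ennreal_ofReal]
    convert measure_empty (μ := ν)
    ext x
    simp only [Set.mem_inter_iff, Set.mem_ofPred_eq, Set.mem_empty_iff_false, iff_false, not_and]
    intro h h'
    simp [h'] at h
  have hP0 := hPQ hQ0
  rw [hP, withDensity_apply_eq_zero hp₀.ennreal_ofReal] at hP0
  rw [hQ, ← withDensity_mul ν hq₀.ennreal_ofReal hg₀m.ennreal_ofReal, hP]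
  refine withDensity_congr_ae ?_
  have hae : ∀ᵐ x ∂ν, ¬ (ENNReal.ofReal (p₀ x) ≠ 0 ∧ q₀ x = 0) := by
    rw [ae_iff]
    simp only [not_not]
    exact hP0
  filter_upwards [hae] with x hx
  rw [Pi.mul_apply, ← ENNReal.ofReal_mul (hq₀_nonneg x), hg₀]
  by_cases h : q₀ x = 0
  · have : ENNReal.ofReal (p₀ x) = 0 := by
      by_contra h'
      exact hx ⟨h', h⟩
    rw [this, h]; simp
  · rw [mul_div_cancel₀ _ h]

section Density

variable {P Q : Measure 𝒳} {g₀ : 𝒳 → ℝ}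

lemma ae_pos_of_eq_withDensity (hg₀ : Measurable g₀)
    (hPQ : P = Q.withDensity fun x => ENNReal.ofReal (g₀ x)) : ∀ᵐ x ∂P, 0 < g₀ x := by
  rw [hPQ, ae_withDensity_iff hg₀.ennreal_ofReal]
  refine Eventually.of_forall fun x hx => ?_
  by_contra! h
  exact hx (ENNReal.ofReal_of_nonpos h)

lemma integrable_density [IsFiniteMeasure P] (hg₀ : Measurable g₀) (hg₀_nonneg : ∀ x, 0 ≤ g₀ x)
    (hPQ : P = Q.withDensity fun x => ENNReal.ofReal (g₀ x)) : Integrable g₀ Q := by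
  refine (lintegral_ofReal_ne_top_iff_integrable hg₀.aestronglyMeasurable
    (Eventually.of_forall hg₀_nonneg)).1 ?_
  have := measure_ne_top P Set.univ
  rwa [hPQ, withDensity_apply _ MeasurableSet.univ, Measure.restrict_univ] at this

lemma integral_density [IsProbabilityMeasure P] (hg₀ : Measurable g₀)
    (hg₀_nonneg : ∀ x, 0 ≤ g₀ x)
    (hPQ : P = Q.withDensity fun x => ENNReal.ofReal (g₀ x)) : ∫ x, g₀ x ∂Q = 1 := by
  rw [integral_eq_lintegral_of_nonneg_ae (Eventually.of_forall hg₀_nonneg)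
    hg₀.aestronglyMeasurable]
  have := measure_univ (μ := P)
  rw [hPQ, withDensity_apply _ MeasurableSet.univ, Measure.restrict_univ] at this
  rw [this, ENNReal.toReal_one]

/-- The squared Hellinger distance is bounded by the loss in expected log-likelihood. -/
lemma hellinger_sq_le (hg₀ : Measurable g₀) (hg₀_nonneg : ∀ x, 0 ≤ g₀ x)
    (hPQ : P = Q.withDensity fun x => ENNReal.ofReal (g₀ x)) (hg₀_int : Integrable g₀ Q)
    {g : 𝒳 → ℝ} (hg : Measurable g) (hg_nonneg : ∀ x, 0 ≤ g x) (hg_int : Integrable g Q)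
    (hlog : Integrable (fun x => Real.log (g x / g₀ x)) P) (hpos : ∀ᵐ x ∂P, 0 < g x) :
    0 ≤ ∫ x, (g x - g₀ x) ∂Q - ∫ x, Real.log (g x / g₀ x) ∂P ∧
    ∫⁻ x, ENNReal.ofReal ((√(g₀ x) - √(g x)) ^ 2) ∂Q ≤
      ENNReal.ofReal (∫ x, (g x - g₀ x) ∂Q - ∫ x, Real.log (g x / g₀ x) ∂P) := by
  have hlt : ∀ᵐ x ∂Q, ENNReal.ofReal (g₀ x) < ∞ :=
    Eventually.of_forall fun _ => ENNReal.ofReal_lt_top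
  have hsq : Integrable (fun x => (√(g₀ x) - √(g x)) ^ 2) Q := by
    refine (hg₀_int.add hg_int).mono' (by fun_prop) (Eventually.of_forall fun x => ?_)
    rw [Real.norm_eq_abs, abs_of_nonneg (sq_nonneg _), Pi.add_apply]
    nlinarith [Real.sq_sqrt (hg₀_nonneg x), Real.sq_sqrt (hg_nonneg x),
      mul_nonneg (Real.sqrt_nonneg (g₀ x)) (Real.sqrt_nonneg (g x))]
  have hpos' : ∀ᵐ x ∂Q, g₀ x ≠ 0 → 0 < g x := by
    rw [hPQ, ae_withDensity_iff hg₀.ennreal_ofReal] at hpos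
    filter_upwards [hpos] with x hx h0
    exact hx (by simpa using lt_of_le_of_ne (hg₀_nonneg x) (Ne.symm h0))
  have hlogQ : Integrable (fun x => g₀ x * Real.log (g x / g₀ x)) Q := by
    rw [hPQ, integrable_withDensity_iff_integrable_smul' hg₀.ennreal_ofReal hlt] at hlog
    simpa only [smul_eq_mul, ENNReal.toReal_ofReal (hg₀_nonneg _)] using hlog
  have hlogE : ∫ x, Real.log (g x / g₀ x) ∂P = ∫ x, g₀ x * Real.log (g x / g₀ x) ∂Q := by
    rw [hPQ, integral_withDensity_eq_integral_toReal_smul hg₀.ennreal_ofReal hlt]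
    simp only [smul_eq_mul, ENNReal.toReal_ofReal (hg₀_nonneg _)]
  rw [← ofReal_integral_eq_lintegral_ofReal hsq (Eventually.of_forall fun _ => sq_nonneg _)]
  suffices h : ∫ x, (√(g₀ x) - √(g x)) ^ 2 ∂Q ≤
      ∫ x, (g x - g₀ x) ∂Q - ∫ x, Real.log (g x / g₀ x) ∂P from
    ⟨(integral_nonneg fun _ => sq_nonneg _).trans h, ENNReal.ofReal_le_ofReal h⟩
  have hdiff : Integrable (fun x => g x - g₀ x) Q := hg_int.sub hg₀_int
  rw [hlogE, ← integral_sub hdiff hlogQ]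
  refine integral_mono_ae hsq (hdiff.sub hlogQ) ?_
  filter_upwards [hpos'] with x hx
  have := mul_log_div_le (hg₀_nonneg x) (hg_nonneg x) hx
  linarith

lemma integral_log_density [IsProbabilityMeasure P] [IsProbabilityMeasure Q] (hg₀ : Measurable g₀)
    (hg₀_nonneg : ∀ x, 0 ≤ g₀ x) (hPQ : P = Q.withDensity fun x => ENNReal.ofReal (g₀ x))
    (hA : InformationTheory.klDiv P Q < ∞) :
    Integrable (fun x => Real.log (g₀ x)) P ∧
      ∫ x, Real.log (g₀ x) ∂P = (InformationTheory.klDiv P Q).toReal := by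
  obtain ⟨hac, henvi⟩ := InformationTheory.klDiv_ne_top_iff.1 hA.ne
  have hrn : P.rnDeriv Q =ᵐ[Q] fun x => ENNReal.ofReal (g₀ x) := by
    conv_lhs => rw [hPQ]
    exact Measure.rnDeriv_withDensity Q hg₀.ennreal_ofReal
  have hllr : llr P Q =ᵐ[P] fun x => Real.log (g₀ x) := by
    filter_upwards [hac.ae_eq hrn] with x hx
    rw [llr_def]
    simp only [hx, ENNReal.toReal_ofReal (hg₀_nonneg x)]
  refine ⟨henvi.congr hllr, ?_⟩
  rw [InformationTheory.toReal_klDiv_of_measure_eq hac (by simp), integral_congr_ae hllr]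

end Density

lemma integrable_toReal_of_envelope {μ : Measure 𝒳} {F : Set (𝒳 → EReal)} {f : 𝒳 → EReal}
    (hf : f ∈ F) (hfm : Measurable f) (henvi : ∫⁻ x, envelope F x ∂μ < ∞) :
    Integrable (fun x => (f x).toReal) μ := by
  refine ⟨hfm.ereal_toReal.aestronglyMeasurable, lt_of_le_of_lt (lintegral_mono fun x => ?_) henvi⟩
  rw [Real.enorm_eq_ofReal_abs]
  exact (ofReal_abs_toReal_le _).trans (abs_le_envelope hf x)

lemma strong_law_ae_comp {Pr : Measure Ω} {μ : Measure 𝒳} {Z : ℕ → Ω → 𝒳}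
    (hZ : IsIIDSample Pr μ Z) {g : 𝒳 → ℝ} (hg : Measurable g) (hgi : Integrable g μ) :
    ∀ᵐ ω ∂Pr, Tendsto (fun n : ℕ => (∑ i : Fin n, g (Z i ω)) / n) atTop (𝓝 (∫ x, g x ∂μ)) := by
  have h := strong_law_ae_real (μ := Pr) (fun i ω => g (Z i ω))
    ((hZ.measurePreserving 0).integrable_comp_of_integrable hgi)
    (fun i j hij => (hZ.indep.indepFun hij).comp hg hg)
    (fun i => IdentDistrib.comp ⟨(hZ.measurable i).aemeasurable, (hZ.measurable 0).aemeasurable,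
      by rw [hZ.map_eq, hZ.map_eq]⟩ hg)
  have hm : ∫ ω, g (Z 0 ω) ∂Pr = ∫ x, g x ∂μ := by
    rw [← hZ.map_eq 0, integral_map (hZ.measurable 0).aemeasurable hg.aestronglyMeasurable]
  rw [hm] at h
  filter_upwards [h] with ω hω
  refine hω.congr fun n => ?_
  rw [Finset.sum_range]

lemma tendsto_hellinger_zero {Q : Measure 𝒳} {g₀ : 𝒳 → ℝ} {g : ℕ → 𝒳 → ℝ}
    (h : ∀ ε : ℝ, 0 < ε → ∀ᶠ n in atTop,
      ∫⁻ x, ENNReal.ofReal ((√(g₀ x) - √(g n x)) ^ 2) ∂Q ≤ ENNReal.ofReal ε) :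
    Tendsto (fun n => hellinger Q g₀ (g n)) atTop (𝓝 0) := by
  have h0 : Tendsto (fun n => ∫⁻ x, ENNReal.ofReal ((√(g₀ x) - √(g n x)) ^ 2) ∂Q) atTop
      (𝓝 0) := by
    rw [ENNReal.tendsto_nhds_zero]
    intro ε hε
    obtain ⟨r, hr0, hrε⟩ := ENNReal.lt_iff_exists_nnreal_btwn.1 hε
    have hr : (0 : ℝ) < r := by exact_mod_cast hr0
    filter_upwards [h r hr] with n hn
    exact hn.trans (by rw [ENNReal.ofReal_coe_nnreal]; exact hrε.le)
  have h1 := (ENNReal.Tendsto.div_const h0 (b := 2) (Or.inr (by simp)))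
  have h2 := (ENNReal.continuous_rpow_const (y := (1 / 2 : ℝ))).tendsto ((0 : ℝ≥0∞) / 2)
  have h3 := h2.comp h1
  rw [ENNReal.zero_div, ENNReal.zero_rpow_of_pos (by norm_num)] at h3
  exact h3

section Classes

variable {P Q : Measure 𝒳} {G : Set (𝒳 → ℝ)} {g₀ : 𝒳 → ℝ}

lemma integrable_of_mem {g : 𝒳 → ℝ} (hg : g ∈ G) (hgm : Measurable g) (hg0 : ∀ x, 0 ≤ g x)
    (henvi : ∫⁻ x, envelope (classG G) x ∂Q < ∞) : Integrable g Q :=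
  (lintegral_ofReal_ne_top_iff_integrable hgm.aestronglyMeasurable (Eventually.of_forall hg0)).1
    ((lintegral_mono fun x => ofReal_le_envelope_classG hg x).trans_lt henvi).ne

lemma lintegral_envelope_classSub_lt_top (hG : ∀ g ∈ G, ∀ x, 0 ≤ g x) (hg₀ : Measurable g₀)
    (hg₀_nonneg : ∀ x, 0 ≤ g₀ x) (hg₀_int : Integrable g₀ Q)
    (henvi : ∫⁻ x, envelope (classG G) x ∂Q < ∞) :
    ∫⁻ x, envelope (classSub G g₀) x ∂Q < ∞ := by
  have hle : ∀ x, envelope (classSub G g₀) x ≤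
      envelope (classG G) x + ENNReal.ofReal (g₀ x) := by
    intro x
    refine iSup₂_le ?_
    rintro _ ⟨g, hg, rfl⟩
    rw [EReal.abs_def]
    refine le_trans ?_ (add_le_add_left (ofReal_le_envelope_classG hg x) _)
    rw [← ENNReal.ofReal_add (hG g hg x) (hg₀_nonneg x)]
    refine ENNReal.ofReal_le_ofReal (abs_le.2 ⟨?_, ?_⟩) <;>
    linarith [hG g hg x, hg₀_nonneg x]
  refine (lintegral_mono hle).trans_lt ?_
  rw [lintegral_add_right _ hg₀.ennreal_ofReal]
  exact ENNReal.add_lt_top.2 ⟨henvi, ((lintegral_ofReal_ne_top_iff_integrable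
    hg₀.aestronglyMeasurable (Eventually.of_forall hg₀_nonneg)).2 hg₀_int).lt_top⟩

lemma abs_log_midpoint_le {a b : ℝ} (ha : 0 ≤ a) (hb : 0 < b) :
    |Real.log ((a + b) / (2 * b))| ≤ Real.log 2 + a / b := by
  have hab : 0 ≤ a / b := by positivity
  have e : (a + b) / (2 * b) = (a / b + 1) / 2 := by field_simp
  rw [e, Real.log_div (by positivity) (by norm_num), abs_le]
  have h1 : 0 ≤ Real.log (a / b + 1) := Real.log_nonneg (by linarith)
  have h2 := Real.log_le_sub_one_of_pos (show 0 < a / b + 1 by positivity)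
  have h3 := Real.log_pos (show (1 : ℝ) < 2 by norm_num)
  constructor <;> linarith

/-- The envelope is at most `log 2 + G₀/g₀`, and the density `g₀` of `P` cancels the denominator,
leaving `∫ G₀ dQ`. This is why (b) needs no envelope condition under `P`. -/
lemma lintegral_envelope_classLogMid_lt_top [IsFiniteMeasure P] (hG : ∀ g ∈ G, ∀ x, 0 ≤ g x)
    (hg₀ : Measurable g₀) (hPQ : P = Q.withDensity fun x => ENNReal.ofReal (g₀ x))
    (henvi : ∫⁻ x, envelope (classG G) x ∂Q < ∞) :
    ∫⁻ x, envelope (classLogMid G g₀) x ∂P < ∞ := by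
  have hle : ∀ᵐ x ∂P, envelope (classLogMid G g₀) x ≤
      ENNReal.ofReal (Real.log 2) + (ENNReal.ofReal (g₀ x))⁻¹ * envelope (classG G) x := by
    filter_upwards [ae_pos_of_eq_withDensity hg₀ hPQ] with x hx
    refine iSup₂_le ?_
    rintro _ ⟨g, hg, rfl⟩
    have hgx := hG g hg x
    simp only
    rw [elog_of_pos (by positivity), EReal.abs_def]
    refine (ENNReal.ofReal_le_ofReal (abs_log_midpoint_le hgx hx)).trans ?_
    rw [ENNReal.ofReal_add (Real.log_nonneg (by norm_num)) (by positivity),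
      ENNReal.ofReal_div_of_pos hx, ENNReal.div_eq_inv_mul]
    gcongr
    exact ofReal_le_envelope_classG hg x
  refine (lintegral_mono_ae hle).trans_lt ?_
  rw [lintegral_add_left measurable_const, lintegral_const]
  refine ENNReal.add_lt_top.2 ⟨ENNReal.mul_lt_top ENNReal.ofReal_lt_top (measure_lt_top _ _),
    lt_of_le_of_lt ?_ henvi⟩
  rw [hPQ]
  refine (lintegral_withDensity_le_lintegral_mul Q hg₀.ennreal_ofReal _).trans
    (lintegral_mono fun x => ?_)
  simp only [Pi.mul_apply]
  rw [← mul_assoc]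
  refine (mul_le_mul_left (ENNReal.mul_inv_le_one _) _).trans ?_
  rw [one_mul]

end Classes

end KLEstimation

end

/-! ### Consistency of the estimates. -/

noncomputable section

namespace KLEstimation

variable {𝒳 Ω : Type*} [MeasurableSpace 𝒳] [MeasurableSpace Ω] {Pr : Measure Ω}
  {P Q : Measure 𝒳} {G : Set (𝒳 → ℝ)} {g₀ : 𝒳 → ℝ} {X Y : ℕ → Ω → 𝒳} {ghat : ℕ → Ω → 𝒳 → ℝ}

lemma measurable_of_mem_classSub (hG : ∀ g ∈ G, Measurable g) (hg₀ : Measurable g₀) :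
    ∀ f ∈ classSub G g₀, Measurable f := by
  rintro _ ⟨g, hg, rfl⟩
  exact measurable_coe_real_ereal.comp ((hG g hg).sub hg₀)

lemma measurable_of_mem_classLog (hG : ∀ g ∈ G, Measurable g) (hg₀ : Measurable g₀) :
    ∀ f ∈ classLog G g₀, Measurable f := by
  rintro _ ⟨g, hg, rfl⟩
  exact measurable_elog.comp ((hG g hg).div hg₀)

lemma measurable_of_mem_classLogMid (hG : ∀ g ∈ G, Measurable g) (hg₀ : Measurable g₀) :
    ∀ f ∈ classLogMid G g₀, Measurable f := by
  rintro _ ⟨g, hg, rfl⟩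
  exact measurable_elog.comp (((hG g hg).add hg₀).div (hg₀.const_mul 2))

/-- Eventual almost sure uniform closeness of empirical sums to their expectations, for the
class `G - g₀`. -/
lemma ae_eventually_sub_le [IsProbabilityMeasure Pr] [IsProbabilityMeasure Q]
    (hne : G.Nonempty) (hG_meas : ∀ g ∈ G, Measurable g) (hG : ∀ g ∈ G, ∀ x, 0 ≤ g x)
    (hg₀ : Measurable g₀) (hg₀_nonneg : ∀ x, 0 ≤ g₀ x) (hg₀_int : Integrable g₀ Q)
    (hY : IsIIDSample Pr Q Y) (henv : ∫⁻ x, envelope (classG G) x ∂Q < ∞)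
    (hmeas : SupMeasurable Q (classSub G g₀)) (hent : EntropyCondition Pr Y (classSub G g₀)) :
    ∀ᵐ ω ∂Pr, ∀ ε : ℝ, 0 < ε → ∀ᶠ n : ℕ in atTop, ∀ g ∈ G,
      |∑ i : Fin n, (g (Y i ω) - g₀ (Y i ω)) - n * ∫ x, (g x - g₀ x) ∂Q| ≤ ε * n := by
  filter_upwards [ae_eventually_uniform_sum_le (hne.image _)
    (measurable_of_mem_classSub hG_meas hg₀) hmeas
    (lintegral_envelope_classSub_lt_top hG hg₀ hg₀_nonneg hg₀_int henv) hY hent] with ω hω ε hε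
  filter_upwards [hω ε hε] with n hn g hg
  simpa only [EReal.toReal_coe] using hn _ (Set.mem_image_of_mem _ hg)

/-- The empirical log-likelihood ratio of the estimate against `g₀` is nonnegative. -/
lemma ae_loglik_nonneg [IsProbabilityMeasure Pr] (hPQ : P ≪ Q) (hpos : ∀ᵐ x ∂P, 0 < g₀ x)
    (hB : ∃ g ∈ G, g =ᵐ[Q] g₀) (hX : IsIIDSample Pr P X) (hY : IsIIDSample Pr Q Y)
    (hghat : ∀ᵐ ω ∂Pr, ∀ n : ℕ, 1 ≤ n →
      IsE1Estimate G (fun i : Fin n => X i ω) (fun i : Fin n => Y i ω) (ghat n ω)) :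
    ∀ᵐ ω ∂Pr, (∀ i, 0 < g₀ (X i ω)) ∧ ∀ n : ℕ, 1 ≤ n → ghat n ω ∈ G ∧
      (∀ i : Fin n, 0 < ghat n ω (X i ω)) ∧
      0 ≤ ∑ i : Fin n, Real.log (ghat n ω (X i ω) / g₀ (X i ω))
        - ∑ i : Fin n, (ghat n ω (Y i ω) - g₀ (Y i ω)) := by
  obtain ⟨gs, hgs, hgsQ⟩ := hB
  have h1 : ∀ᵐ ω ∂Pr, ∀ i, 0 < g₀ (X i ω) := ae_all_iff.2 fun i =>
    (hX.measurePreserving i).quasiMeasurePreserving.ae hpos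
  have h2 : ∀ᵐ ω ∂Pr, ∀ i, gs (X i ω) = g₀ (X i ω) := ae_all_iff.2 fun i =>
    (hX.measurePreserving i).quasiMeasurePreserving.ae (hPQ.ae_eq hgsQ)
  have h3 : ∀ᵐ ω ∂Pr, ∀ i, gs (Y i ω) = g₀ (Y i ω) := ae_all_iff.2 fun i =>
    (hY.measurePreserving i).quasiMeasurePreserving.ae hgsQ
  filter_upwards [h1, h2, h3, hghat] with ω w1 w2 w3 w4
  refine ⟨w1, fun n hn => ⟨(w4 n hn).1, ?_⟩⟩
  exact pos_and_loglik_nonneg (Nat.one_le_iff_ne_zero.1 hn) (fun i : Fin n => w1 i)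
    (fun i : Fin n => w2 i) (fun i : Fin n => w3 i) ((w4 n hn).2 gs hgs)

/-- Consistency under entropy conditions on the class `log (G / g₀)`. -/
theorem consistency_of_classLog [IsProbabilityMeasure Pr] [IsProbabilityMeasure P]
    [IsProbabilityMeasure Q] (hg₀ : Measurable g₀) (hg₀_nonneg : ∀ x, 0 ≤ g₀ x)
    (hPQ : P = Q.withDensity fun x => ENNReal.ofReal (g₀ x))
    (hG_meas : ∀ g ∈ G, Measurable g) (hG : ∀ g ∈ G, ∀ x, 0 ≤ g x)
    (hA : InformationTheory.klDiv P Q < ∞) (hB : ∃ g ∈ G, g =ᵐ[Q] g₀)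
    (hX : IsIIDSample Pr P X) (hY : IsIIDSample Pr Q Y)
    (hghat : ∀ᵐ ω ∂Pr, ∀ n : ℕ, 1 ≤ n →
      IsE1Estimate G (fun i : Fin n => X i ω) (fun i : Fin n => Y i ω) (ghat n ω))
    (hQ_env : ∫⁻ x, envelope (classG G) x ∂Q < ∞) (hQ_meas : SupMeasurable Q (classSub G g₀))
    (hQ_ent : EntropyCondition Pr Y (classSub G g₀))
    (hP_env : ∫⁻ x, envelope (classLog G g₀) x ∂P < ∞)
    (hP_meas : SupMeasurable P (classLog G g₀))
    (hP_ent : EntropyCondition Pr X (classLog G g₀)) :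
    (∀ᵐ ω ∂Pr, Tendsto
      (fun n : ℕ => klEstimate (fun i : Fin n => X i ω) (fun i : Fin n => Y i ω) (ghat n ω))
      atTop (𝓝 ((InformationTheory.klDiv P Q : ℝ≥0∞) : EReal))) ∧
    (∀ᵐ ω ∂Pr, Tendsto (fun n : ℕ => hellinger Q g₀ (ghat n ω)) atTop (𝓝 0)) := by
  have hne : G.Nonempty := hB.imp fun _ h => h.1
  have hac : P ≪ Q := hPQ ▸ withDensity_absolutelyContinuous _ _
  have hpos := ae_pos_of_eq_withDensity hg₀ hPQ
  have hg₀_int := integrable_density hg₀ hg₀_nonneg hPQ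
  have hlog_meas := measurable_of_mem_classLog hG_meas hg₀
  have htoReal : ∀ g ∈ G, ∀ x, (elog (g x / g₀ x)).toReal = Real.log (g x / g₀ x) :=
    fun g hg x => toReal_elog (div_nonneg (hG g hg x) (hg₀_nonneg x))
  have hbound : ∀ g ∈ G, 0 ≤ ∫ x, (g x - g₀ x) ∂Q - ∫ x, Real.log (g x / g₀ x) ∂P ∧
      ∫⁻ x, ENNReal.ofReal ((√(g₀ x) - √(g x)) ^ 2) ∂Q ≤
      ENNReal.ofReal (∫ x, (g x - g₀ x) ∂Q - ∫ x, Real.log (g x / g₀ x) ∂P) := by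
    intro g hg
    refine hellinger_sq_le hg₀ hg₀_nonneg hPQ hg₀_int (hG_meas g hg) (hG g hg)
      (integrable_of_mem hg (hG_meas g hg) (hG g hg) hQ_env) ?_ ?_
    · have := integrable_toReal_of_envelope (Set.mem_image_of_mem _ hg)
        (hlog_meas _ (Set.mem_image_of_mem _ hg)) hP_env
      simpa only [htoReal g hg] using this
    -- A zero of `g` would put `log 0 = -∞` into the class and make the envelope infinite.
    · filter_upwards [ae_lt_top' hP_meas.aemeasurable_envelope hP_env.ne] with x hx
      by_contra! h
      have := (abs_le_envelope (Set.mem_image_of_mem _ hg) x).trans_lt hx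
      rw [elog_of_nonpos (div_nonpos_of_nonpos_of_nonneg h (hg₀_nonneg x))] at this
      simp at this
  have hkey : ∀ᵐ ω ∂Pr, ∀ ε : ℝ, 0 < ε → ∀ᶠ n : ℕ in atTop,
      ∑ i : Fin n, Real.log (ghat n ω (X i ω) / g₀ (X i ω))
        - ∑ i : Fin n, (ghat n ω (Y i ω) - g₀ (Y i ω)) ≤
        n * (∫ x, Real.log (ghat n ω x / g₀ x) ∂P - ∫ x, (ghat n ω x - g₀ x) ∂Q) + ε * n := by
    filter_upwards [ae_loglik_nonneg hac hpos hB hX hY hghat,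
      ae_eventually_sub_le hne hG_meas hG hg₀ hg₀_nonneg hg₀_int hY hQ_env hQ_meas hQ_ent,
      ae_eventually_uniform_sum_le (hne.image _) hlog_meas hP_meas hP_env hX hP_ent]
      with ω w1 w2 w3 ε hε
    filter_upwards [w2 (ε / 2) (by positivity), w3 (ε / 2) (by positivity),
      eventually_ge_atTop 1] with n hn2 hn3 hn
    have hmem := (w1.2 n hn).1
    have h2 := abs_le.1 (hn2 _ hmem)
    have h3 := abs_le.1 (hn3 _ (Set.mem_image_of_mem _ hmem))
    simp only [htoReal _ hmem] at h3
    linarith [h2.1, h3.2]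
  obtain ⟨hlog_int, hlog_eq⟩ := integral_log_density hg₀ hg₀_nonneg hPQ hA
  constructor
  · filter_upwards [ae_loglik_nonneg hac hpos hB hX hY hghat, hkey,
      strong_law_ae_comp hX hg₀.log hlog_int, strong_law_ae_comp hY hg₀ hg₀_int]
      with ω w1 w2 w3 w4
    have hzero : Tendsto (fun n : ℕ => (∑ i : Fin n, Real.log (ghat n ω (X i ω) / g₀ (X i ω))
        - ∑ i : Fin n, (ghat n ω (Y i ω) - g₀ (Y i ω))) / n) atTop (𝓝 0) := by
      rw [Metric.tendsto_nhds]
      intro ε hε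
      filter_upwards [w2 (ε / 2) (by positivity), eventually_ge_atTop 1] with n hn hn1
      have hnpos : (0 : ℝ) < n := by exact_mod_cast hn1
      obtain ⟨hmem, -, hnn⟩ := w1.2 n hn1
      have hb : 0 ≤ ∫ x, (ghat n ω x - g₀ x) ∂Q - ∫ x, Real.log (ghat n ω x / g₀ x) ∂P :=
        (hbound _ hmem).1
      rw [Real.dist_eq, sub_zero, abs_of_nonneg (div_nonneg hnn hnpos.le), div_lt_iff₀ hnpos]
      nlinarith [mul_nonneg hnpos.le hb, mul_pos hε hnpos]
    have hlim := (((hzero.add w3).sub w4).add_const 1)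
    -- The limit is `0 + D - 1 + 1`: the final `+ 1` of the estimate compensates `∫ g₀ dQ = 1`.
    rw [integral_density hg₀ hg₀_nonneg hPQ, hlog_eq] at hlim
    have hlim' := (continuous_coe_real_ereal.tendsto _).comp hlim
    rw [zero_add, sub_add_cancel, EReal.coe_ennreal_toReal hA.ne] at hlim'
    refine hlim'.congr' ?_
    filter_upwards [eventually_ge_atTop 1] with n hn
    rw [klEstimate_of_pos (fun i : Fin n => w1.1 i) (w1.2 n hn).2.1]
    rfl
  · filter_upwards [ae_loglik_nonneg hac hpos hB hX hY hghat, hkey] with ω w1 w2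
    refine tendsto_hellinger_zero fun ε hε => ?_
    filter_upwards [w2 ε hε, eventually_ge_atTop 1] with n hn hn1
    have hnpos : (0 : ℝ) < n := by exact_mod_cast hn1
    obtain ⟨hmem, -, hnn⟩ := w1.2 n hn1
    refine (hbound _ hmem).2.trans (ENNReal.ofReal_le_ofReal ?_)
    refine le_of_mul_le_mul_left ?_ hnpos
    linarith

/-- Hellinger consistency under entropy conditions on the class `log ((G + g₀) / (2 g₀))`. -/
theorem hellinger_consistency_of_classLogMid [IsProbabilityMeasure Pr] [IsProbabilityMeasure P]
    [IsProbabilityMeasure Q] (hg₀ : Measurable g₀) (hg₀_nonneg : ∀ x, 0 ≤ g₀ x)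
    (hPQ : P = Q.withDensity fun x => ENNReal.ofReal (g₀ x))
    (hG_meas : ∀ g ∈ G, Measurable g) (hG : ∀ g ∈ G, ∀ x, 0 ≤ g x)
    (hB : ∃ g ∈ G, g =ᵐ[Q] g₀)
    (hX : IsIIDSample Pr P X) (hY : IsIIDSample Pr Q Y)
    (hghat : ∀ᵐ ω ∂Pr, ∀ n : ℕ, 1 ≤ n →
      IsE1Estimate G (fun i : Fin n => X i ω) (fun i : Fin n => Y i ω) (ghat n ω))
    (hQ_env : ∫⁻ x, envelope (classG G) x ∂Q < ∞) (hQ_meas : SupMeasurable Q (classSub G g₀))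
    (hQ_ent : EntropyCondition Pr Y (classSub G g₀))
    (hP_meas : SupMeasurable P (classLogMid G g₀))
    (hP_ent : EntropyCondition Pr X (classLogMid G g₀)) :
    ∀ᵐ ω ∂Pr, Tendsto (fun n : ℕ => hellinger Q g₀ (ghat n ω)) atTop (𝓝 0) := by
  have hne : G.Nonempty := hB.imp fun _ h => h.1
  have hac : P ≪ Q := hPQ ▸ withDensity_absolutelyContinuous _ _
  have hpos := ae_pos_of_eq_withDensity hg₀ hPQ
  have hg₀_int := integrable_density hg₀ hg₀_nonneg hPQ
  have hlog_meas := measurable_of_mem_classLogMid hG_meas hg₀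
  have hP_env := lintegral_envelope_classLogMid_lt_top hG hg₀ hPQ hQ_env
  have htoReal : ∀ g ∈ G, ∀ x, (elog ((g x + g₀ x) / (2 * g₀ x))).toReal =
      Real.log ((g x + g₀ x) / (2 * g₀ x)) := fun g hg x =>
    toReal_elog (div_nonneg (add_nonneg (hG g hg x) (hg₀_nonneg x))
      (mul_nonneg (by norm_num) (hg₀_nonneg x)))
  have hbound : ∀ g ∈ G, ∫⁻ x, ENNReal.ofReal ((√(g₀ x) - √(g x)) ^ 2) ∂Q ≤
      ENNReal.ofReal (16 * ((∫ x, (g x - g₀ x) ∂Q) / 2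
        - ∫ x, Real.log ((g x + g₀ x) / (2 * g₀ x)) ∂P)) := by
    intro g hg
    have hgi := integrable_of_mem hg (hG_meas g hg) (hG g hg) hQ_env
    have hdiv : ∀ x, (g x + g₀ x) / 2 / g₀ x = (g x + g₀ x) / (2 * g₀ x) := fun x => div_div _ _ _
    have hsub : ∀ x, (g x + g₀ x) / 2 - g₀ x = (g x - g₀ x) / 2 := fun x => by ring
    -- The Hellinger bound is applied to the midpoint, whose difference from `g₀` is half of `g -
    -- g₀`, so the class `G - g₀` is reused.
    have hmid := (hellinger_sq_le hg₀ hg₀_nonneg hPQ hg₀_int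
      (g := fun x => (g x + g₀ x) / 2) (((hG_meas g hg).add hg₀).div_const 2)
      (fun x => div_nonneg (add_nonneg (hG g hg x) (hg₀_nonneg x)) (by norm_num))
      ((hgi.add hg₀_int).div_const 2) (by
        have := integrable_toReal_of_envelope (Set.mem_image_of_mem _ hg)
          (hlog_meas _ (Set.mem_image_of_mem _ hg)) hP_env
        simpa only [htoReal g hg, hdiv] using this) (by
        filter_upwards [hpos] with x hx
        have := hG g hg x
        positivity)).2
    simp only [hdiv, hsub] at hmid
    rw [integral_div] at hmid
    rw [ENNReal.ofReal_mul (by norm_num)]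
    refine le_trans ?_ (mul_le_mul_right hmid _)
    rw [← lintegral_const_mul' _ _ ENNReal.ofReal_ne_top]
    refine lintegral_mono fun x => ?_
    rw [← ENNReal.ofReal_mul (by norm_num)]
    exact ENNReal.ofReal_le_ofReal (sq_sqrt_sub_sqrt_le_midpoint (hg₀_nonneg x) (hG g hg x))
  filter_upwards [ae_loglik_nonneg hac hpos hB hX hY hghat,
    ae_eventually_sub_le hne hG_meas hG hg₀ hg₀_nonneg hg₀_int hY hQ_env hQ_meas hQ_ent,
    ae_eventually_uniform_sum_le (hne.image _) hlog_meas hP_meas hP_env hX hP_ent]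
    with ω w1 w2 w3
  refine tendsto_hellinger_zero fun ε hε => ?_
  -- The log-sum enters twice and the difference once, an error of `3ε/32`; half of the factor `16`
  -- turns it into `3ε/4`.
  filter_upwards [w2 (ε / 32) (by positivity), w3 (ε / 32) (by positivity),
    eventually_ge_atTop 1] with n hn2 hn3 hn
  have hnpos : (0 : ℝ) < n := by exact_mod_cast hn
  obtain ⟨hmem, hgpos, hnn⟩ := w1.2 n hn
  have h2 := abs_le.1 (hn2 _ hmem)
  have h3 := abs_le.1 (hn3 _ (Set.mem_image_of_mem _ hmem))
  simp only [htoReal _ hmem] at h3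
  -- Concavity of the logarithm, in the form `4ab ≤ (a + b)²`, passes the basic inequality to the
  -- midpoint.
  have hconc : ∑ i : Fin n, Real.log (ghat n ω (X i ω) / g₀ (X i ω)) ≤
      2 * ∑ i : Fin n, Real.log ((ghat n ω (X i ω) + g₀ (X i ω)) / (2 * g₀ (X i ω))) := by
    rw [Finset.mul_sum]
    refine Finset.sum_le_sum fun i _ => ?_
    have ha := hgpos i
    have hb := w1.1 i
    have e : 2 * Real.log ((ghat n ω (X i ω) + g₀ (X i ω)) / (2 * g₀ (X i ω)))
        = Real.log (((ghat n ω (X i ω) + g₀ (X i ω)) / (2 * g₀ (X i ω))) ^ 2) := by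
      rw [Real.log_pow]; norm_num
    rw [e]
    refine Real.log_le_log (by positivity) ?_
    rw [div_pow, div_le_div_iff₀ hb (by positivity)]
    nlinarith [mul_nonneg hb.le (sq_nonneg (ghat n ω (X i ω) - g₀ (X i ω)))]
  refine (hbound _ hmem).trans (ENNReal.ofReal_le_ofReal ?_)
  refine le_of_mul_le_mul_left ?_ hnpos
  linarith [h2.1, h3.2]

end KLEstimation

end

theorem theorem1
    {𝒳 Ω : Type*} [MeasurableSpace 𝒳] [MeasurableSpace Ω]
    (Pr : Measure Ω) [IsProbabilityMeasure Pr]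
    -- distributions `P`, `Q` with densities `p₀`, `q₀`, and the ratio `g₀ = p₀ / q₀`
    (ν P Q : Measure 𝒳) [IsProbabilityMeasure P] [IsProbabilityMeasure Q]
    (p₀ q₀ g₀ : 𝒳 → ℝ) (hp₀ : Measurable p₀) (hq₀ : Measurable q₀)
    (hp₀_nonneg : ∀ x, 0 ≤ p₀ x) (hq₀_nonneg : ∀ x, 0 ≤ q₀ x)
    (hP : P = ν.withDensity fun x => ENNReal.ofReal (p₀ x))
    (hQ : Q = ν.withDensity fun x => ENNReal.ofReal (q₀ x))
    (hg₀ : ∀ x, g₀ x = p₀ x / q₀ x)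
    -- the class `G` of nonnegative measurable functions
    (G : Set (𝒳 → ℝ)) (hG_meas : ∀ g ∈ G, Measurable g) (hG_nonneg : ∀ g ∈ G, ∀ x, 0 ≤ g x)
    -- assumptions (A) and (B)
    (hA : InformationTheory.klDiv P Q < ∞)
    (hB : ∃ g ∈ G, g =ᵐ[Q] g₀)
    -- the samples and the estimates
    (X Y : ℕ → Ω → 𝒳)
    (hX : KLEstimation.IsIIDSample Pr P X) (hY : KLEstimation.IsIIDSample Pr Q Y)
    (ghat : ℕ → Ω → 𝒳 → ℝ)
    (hghat : ∀ᵐ ω ∂Pr, ∀ n : ℕ, 1 ≤ n →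
      KLEstimation.IsE1Estimate G (fun i : Fin n => X i ω) (fun i : Fin n => Y i ω) (ghat n ω))
    -- the conditions under `Q`, common to both parts
    (hQ_env : ∫⁻ x, KLEstimation.envelope (KLEstimation.classG G) x ∂Q < ∞)
    (hQ_meas : KLEstimation.SupMeasurable Q (KLEstimation.classSub G g₀))
    (hQ_ent : KLEstimation.EntropyCondition Pr Y (KLEstimation.classSub G g₀)) :
    -- part (a)
    (∫⁻ x, KLEstimation.envelope (KLEstimation.classLog G g₀) x ∂P < ∞ →
      KLEstimation.SupMeasurable P (KLEstimation.classLog G g₀) →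
      KLEstimation.EntropyCondition Pr X (KLEstimation.classLog G g₀) →
      (∀ᵐ ω ∂Pr, Tendsto
        (fun n : ℕ => KLEstimation.klEstimate (fun i : Fin n => X i ω) (fun i : Fin n => Y i ω)
          (ghat n ω))
        atTop (𝓝 ((InformationTheory.klDiv P Q : ℝ≥0∞) : EReal))) ∧
      (∀ᵐ ω ∂Pr, Tendsto (fun n : ℕ => KLEstimation.hellinger Q g₀ (ghat n ω)) atTop (𝓝 0))) ∧
    -- part (b)
    (KLEstimation.SupMeasurable P (KLEstimation.classLogMid G g₀) →
      KLEstimation.EntropyCondition Pr X (KLEstimation.classLogMid G g₀) →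
      ∀ᵐ ω ∂Pr, Tendsto (fun n : ℕ => KLEstimation.hellinger Q g₀ (ghat n ω)) atTop (𝓝 0)) := by
  have hg₀m : Measurable g₀ := by
    rw [funext hg₀]
    exact hp₀.div hq₀
  have hg₀_nonneg : ∀ x, 0 ≤ g₀ x := fun x => by
    rw [hg₀]
    exact div_nonneg (hp₀_nonneg x) (hq₀_nonneg x)
  have hPQ := KLEstimation.eq_withDensity_ratio hp₀ hq₀ hq₀_nonneg hP hQ hg₀
    (InformationTheory.klDiv_ne_top_iff.1 hA.ne).1
  exact ⟨KLEstimation.consistency_of_classLog hg₀m hg₀_nonneg hPQ hG_meas hG_nonneg hA hB hX hY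
      hghat hQ_env hQ_meas hQ_ent,
    KLEstimation.hellinger_consistency_of_classLogMid hg₀m hg₀_nonneg hPQ hG_meas hG_nonneg hB
      hX hY hghat hQ_env hQ_meas hQ_ent⟩
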